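/- Let $Q_n$ be the $n$-dimensional Boolean hypercube, i.e. the graph with vertex set $\{-1,1\}^n$ in which two vertices are adjacent when they differ in precisely one entry. For an integer $k\ge 0$, a $k$-function on $Q_n$ is a function $f:\{-1,1\}^n\to\{-1,1\}$ such that every vertex $v$ has precisely $k$ neighbours $w$ with $f(w)\neq f(v)$. Two such functions $f,g$ are isomorphic if $f=\epsilon\, g\circ\phi$ for some graph automorphism $\phi$ of $Q_n$ and some sign $\epsilon\in\{-1,1\}$. Let $G(n,k)$ denote the number of isomorphism classes of $k$-functions on $Q_n$. Theorem. Let $k\ge 0$ be an integer. Then the sequence $(G(n,k))_{n=k}^{\infty}$ is nondecreasing and eventually constant. Moreover, if $n(k)$ denotes the least integer $N\ge k$ such that $G(n,k)=G(N,k)$ for all integers $n\ge N$, then $$3\cdot 2^{k-1}-2\;\le\; n(k)\;\le\; 4.394\cdot 2^{k}.$$ -/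

import Mathlib

namespace HypercubeStable

/-- The `n`-dimensional Boolean hypercube `Q_n`: its vertex set is `{-1, 1}ⁿ` (here `ℤˣ = {1, -1}`),
and two vertices are adjacent when they differ in precisely one entry. -/
def cube (n : ℕ) : SimpleGraph (Fin n → ℤˣ) where
  Adj x y := hammingDist x y = 1
  symm := ⟨fun x y h => by rw [hammingDist_comm]; exact h⟩
  loopless := ⟨fun x h => by simp at h⟩

/-- A `k`-function on `Q_n`: a Boolean function `f : V(Q_n) → {-1, 1}` such that every vertex `v`
has precisely `k` neighbours `w` with `f v ≠ f w`. -/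
def IsKFunction (n k : ℕ) (f : (Fin n → ℤˣ) → ℤˣ) : Prop :=
  ∀ v, {w | (cube n).Adj v w ∧ f v ≠ f w}.ncard = k

/-- `f` and `g` are isomorphic if `f = ε g ∘ φ` for some automorphism `φ` of `Q_n` and some sign
`ε ∈ {-1, 1}`. -/
def Isomorphic {n : ℕ} (f g : (Fin n → ℤˣ) → ℤˣ) : Prop :=
  ∃ (φ : cube n ≃g cube n) (ε : ℤˣ), ∀ x, f x = ε * g (φ x)

theorem isomorphic_equivalence (n : ℕ) :
    Equivalence (Isomorphic : ((Fin n → ℤˣ) → ℤˣ) → ((Fin n → ℤˣ) → ℤˣ) → Prop) where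
  refl f := ⟨RelIso.refl _, 1, fun x => by simp⟩
  symm := by
    rintro f g ⟨φ, ε, h⟩
    refine ⟨φ.symm, ε⁻¹, fun x => ?_⟩
    rw [h, RelIso.apply_symm_apply, inv_mul_cancel_left]
  trans := by
    rintro f g l ⟨φ, ε, h⟩ ⟨ψ, δ, h'⟩
    refine ⟨φ.trans ψ, ε * δ, fun x => ?_⟩
    rw [h, h', mul_assoc, RelIso.trans_apply]

/-- Isomorphism as an equivalence relation on the set of `k`-functions on `Q_n`. -/
def kFunctionSetoid (n k : ℕ) : Setoid {f : (Fin n → ℤˣ) → ℤˣ // IsKFunction n k f} where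
  r f g := Isomorphic f.1 g.1
  iseqv := (isomorphic_equivalence n).comap Subtype.val

/-- `G(n, k)`, the number of isomorphism classes of `k`-functions on `Q_n`. -/
noncomputable def G (n k : ℕ) : ℕ := Nat.card (Quotient (kFunctionSetoid n k))

end HypercubeStable

/-! Stability is a question about relevant variables. Adding a dummy coordinate injects the classes
on `Q_n` into those on `Q_{n+1}` (`extendClass_injective`), and this injection is onto exactly when
every `k`-function on `Q_{n+1}` ignores some coordinate.

Lower bound: `double` turns a `k`-function depending on all of its `m` variables into a
`(k+1)`-function depending on all of `2m + 2` variables. Starting from one variable this reaches `3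
* 2^(k-1) - 2` variables, and `G` jumps there (`G_lt_succ`).

Upper bound: a `k`-function is an eigenfunction of the cube Laplacian, so it has degree at most `k`
(`degLE_of_sensitivity`). It remains to bound the relevant variables of a Boolean `f` of degree at
most `k` (`card_relevant_le`). Each of them has a nonzero derivative of degree below `k`, so it
contributes at least `2^(-k)` to `weight f`, half the sum of `2^(-deg)` over the nonzero
derivatives. The weight is bounded independently of the degree (`weight_le_const`), by two
estimates.

Small degree `d`: `weight f ≤ (d+1)/3` (`weight_le`). The influence of a direction is either equal
to the `omega` of its derivative or at least `3/2` of it (`omega_gap`). The total influence is at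
most `d`, and the directions with equality account for at most `2` of it (`infl_le_two_of_tight`).

Large degree: fixing the variables of a maximal disjoint family of top-degree monomials lowers the
degree at a small cost per monomial, and each monomial uses up a disjoint sensitive block
(`exists_restr`). Markov's inequality allows at most `d^2` such blocks (`HasBlocks.le_sq`), and a
potential function adds up the costs (`weight_le_blocks`). -/

namespace HypercubeStable

open Finset Function
open scoped BigOperators symmDiff

/-! ### Fourier analysis on the hypercube. -/

section Fourier

variable {ι : Type*} [Fintype ι] [DecidableEq ι]

/-- The character `x ↦ ∏ i ∈ S, x i` of the hypercube. -/
def chi (S : Finset ι) (x : ι → ℤˣ) : ℝ := ∏ i ∈ S, ((x i : ℤ) : ℝ)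

/-- Negate the entries indexed by `T`. -/
def flip (T : Finset ι) (x : ι → ℤˣ) : ι → ℤˣ := fun i => if i ∈ T then -x i else x i

/-- The Fourier coefficient of `f` at `S`. -/
noncomputable def coeff (f : (ι → ℤˣ) → ℝ) (S : Finset ι) : ℝ := 𝔼 x, f x * chi S x

/-- `f` is a polynomial of degree at most `d`. -/
def DegLE (f : (ι → ℤˣ) → ℝ) (d : ℕ) : Prop := ∀ S, coeff f S ≠ 0 → #S ≤ d

omit [Fintype ι] in
lemma flip_apply (T : Finset ι) (x : ι → ℤˣ) (i : ι) :
    flip T x i = if i ∈ T then -x i else x i := rfl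

omit [Fintype ι] in
@[simp] lemma flip_flip (T : Finset ι) (x : ι → ℤˣ) : flip T (flip T x) = x := by
  funext i; by_cases h : i ∈ T <;> simp [flip, h]

omit [Fintype ι] in
@[simp] lemma flip_empty (x : ι → ℤˣ) : flip ∅ x = x := by
  funext i; simp [flip]

omit [Fintype ι] in
lemma flip_symmDiff (S T : Finset ι) (x : ι → ℤˣ) : flip S (flip T x) = flip (S ∆ T) x := by
  funext i; by_cases h : i ∈ T <;> by_cases h' : i ∈ S <;> simp [flip, h, h', mem_symmDiff]

omit [Fintype ι] in
lemma flip_comm (S T : Finset ι) (x : ι → ℤˣ) : flip S (flip T x) = flip T (flip S x) := by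
  rw [flip_symmDiff, flip_symmDiff, symmDiff_comm]

omit [Fintype ι] in
lemma flip_left_injective (x : ι → ℤˣ) : Injective fun T => flip T x := by
  intro S T h
  ext i
  have := congrFun h i
  by_cases h1 : i ∈ S <;> by_cases h2 : i ∈ T <;> simp_all [flip, units_ne_neg_self]

lemma expect_flip (T : Finset ι) (h : (ι → ℤˣ) → ℝ) : 𝔼 x, h (flip T x) = 𝔼 x, h x :=
  Fintype.expect_bijective (flip T) (show Involutive (flip T) from flip_flip T).bijective _ _
    fun _ => rfl

omit [Fintype ι] [DecidableEq ι] in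
@[simp] lemma chi_empty (x : ι → ℤˣ) : chi ∅ x = 1 := by simp [chi]

lemma unit_mul_self (u : ℤˣ) : ((u : ℤ) : ℝ) * ((u : ℤ) : ℝ) = 1 := by
  rcases Int.units_eq_one_or u with h | h <;> simp [h]

omit [Fintype ι] in
lemma chi_flip (S T : Finset ι) (x : ι → ℤˣ) :
    chi S (flip T x) = (∏ i ∈ T, if i ∈ S then (-1 : ℝ) else 1) * chi S x := by
  have h1 : chi S (flip T x) = (∏ i ∈ S, if i ∈ T then (-1 : ℝ) else 1) * chi S x := by
    rw [chi, chi, ← prod_mul_distrib]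
    refine prod_congr rfl fun i _ => ?_
    by_cases h : i ∈ T <;> simp [flip, h]
  rw [h1]
  congr 1
  rw [prod_ite, prod_ite]
  simp only [prod_const, one_pow, mul_one]
  congr 2
  ext i
  simp [and_comm]

omit [Fintype ι] in
lemma chi_flip_singleton (S : Finset ι) (i : ι) (x : ι → ℤˣ) :
    chi S (flip {i} x) = if i ∈ S then -chi S x else chi S x := by
  rw [chi_flip]; by_cases h : i ∈ S <;> simp [h]

omit [Fintype ι] in
lemma chi_mul_chi (S T : Finset ι) (x : ι → ℤˣ) : chi S x * chi T x = chi (S ∆ T) x := by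
  have hS : chi S x = chi (S \ T) x * chi (S ∩ T) x := by
    rw [chi, chi, chi, ← prod_union (disjoint_sdiff_inter S T), sdiff_union_inter]
  have hT : chi T x = chi (T \ S) x * chi (S ∩ T) x := by
    rw [chi, chi, chi, inter_comm, ← prod_union (disjoint_sdiff_inter T S), sdiff_union_inter]
  have hU : chi (S ∆ T) x = chi (S \ T) x * chi (T \ S) x := by
    rw [chi, chi, chi, ← prod_union]
    · rfl
    · exact disjoint_sdiff_sdiff
  have h1 : chi (S ∩ T) x * chi (S ∩ T) x = 1 := by
    rw [chi, ← prod_mul_distrib]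
    exact prod_eq_one fun i _ => unit_mul_self _
  rw [hS, hT, hU]
  linear_combination (chi (S \ T) x * chi (T \ S) x) * h1

omit [Fintype ι] in
lemma chi_mul_self (S : Finset ι) (x : ι → ℤˣ) : chi S x * chi S x = 1 := by
  rw [chi_mul_chi]; simp

lemma expect_chi (S : Finset ι) : 𝔼 x : ι → ℤˣ, chi S x = if S = ∅ then 1 else 0 := by
  split_ifs with h
  · subst h; simp
  · obtain ⟨i, hi⟩ := nonempty_iff_ne_empty.mpr h
    have := expect_flip {i} (chi S)
    simp only [chi_flip_singleton, hi, if_true] at this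
    rw [expect_neg_distrib] at this
    linarith

lemma coeff_chi (S T : Finset ι) : coeff (chi S) T = if S = T then 1 else 0 := by
  simp only [coeff, chi_mul_chi, expect_chi]
  congr 1
  simp [symmDiff_eq_bot, ← bot_eq_empty]

lemma coeff_add (f g : (ι → ℤˣ) → ℝ) (S : Finset ι) :
    coeff (fun x => f x + g x) S = coeff f S + coeff g S := by
  simp only [coeff, add_mul, expect_add_distrib]

lemma coeff_sub (f g : (ι → ℤˣ) → ℝ) (S : Finset ι) :
    coeff (fun x => f x - g x) S = coeff f S - coeff g S := by
  simp only [coeff, sub_mul, expect_sub_distrib]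

lemma coeff_const_mul (a : ℝ) (f : (ι → ℤˣ) → ℝ) (S : Finset ι) :
    coeff (fun x => a * f x) S = a * coeff f S := by
  simp only [coeff, mul_assoc, ← mul_expect]

lemma coeff_sum {κ : Type*} (s : Finset κ) (f : κ → (ι → ℤˣ) → ℝ) (S : Finset ι) :
    coeff (fun x => ∑ k ∈ s, f k x) S = ∑ k ∈ s, coeff (f k) S := by
  simp only [coeff, sum_mul, expect_sum_comm]

lemma coeff_sum_chi {κ : Type*} (s : Finset κ) (a : κ → ℝ) (τ : κ → Finset ι) (S : Finset ι) :
    coeff (fun x => ∑ k ∈ s, a k * chi (τ k) x) S = ∑ k ∈ s, if τ k = S then a k else 0 := by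
  rw [coeff_sum]
  refine sum_congr rfl fun k _ => ?_
  rw [coeff_const_mul, coeff_chi]; simp

/-- Fourier inversion. -/
lemma fourier (f : (ι → ℤˣ) → ℝ) (x : ι → ℤˣ) : f x = ∑ S, coeff f S * chi S x := by
  -- The sum over all characters factors as the product of `1 + x i * y i`, which vanishes once `x`
  -- and `y` differ somewhere.
  have key : ∀ y : ι → ℤˣ, ∑ S, chi S y * chi S x =
      if y = x then (Fintype.card (ι → ℤˣ) : ℝ) else 0 := by
    intro y
    have h1 : ∑ S, chi S y * chi S x = ∏ i, (1 + ((y i : ℤ) : ℝ) * ((x i : ℤ) : ℝ)) := by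
      rw [prod_one_add, powerset_univ]
      exact sum_congr rfl fun S _ => by rw [chi, chi, ← prod_mul_distrib]
    rw [h1]
    split_ifs with h
    · subst h
      simp only [unit_mul_self]
      norm_num
    · obtain ⟨i, hi⟩ := Function.ne_iff.mp h
      refine prod_eq_zero (mem_univ i) ?_
      rcases Int.units_eq_one_or (y i) with h1 | h1 <;>
        rcases Int.units_eq_one_or (x i) with h2 | h2 <;> simp_all
  simp only [coeff, expect_mul]
  rw [← expect_sum_comm]
  simp only [mul_assoc, ← mul_sum, key, mul_ite, mul_zero]
  rw [Fintype.expect_eq_sum_div_card]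
  simp

lemma coeff_eq_zero_iff (f : (ι → ℤˣ) → ℝ) : (∀ S, coeff f S = 0) ↔ ∀ x, f x = 0 := by
  refine ⟨fun h x => ?_, fun h S => by simp [coeff, h]⟩
  rw [fourier f x]; simp [h]

lemma parseval (f : (ι → ℤˣ) → ℝ) : 𝔼 x, f x ^ 2 = ∑ S, coeff f S ^ 2 := by
  have : ∀ x, f x ^ 2 = ∑ S, coeff f S * (f x * chi S x) := by
    intro x
    rw [sq]
    nth_rewrite 2 [fourier f x]
    rw [mul_sum]
    exact sum_congr rfl fun S _ => by ring
  simp only [this, expect_sum_comm, ← mul_expect]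
  exact sum_congr rfl fun S _ => by rw [sq]; rfl

lemma DegLE.mono {f : (ι → ℤˣ) → ℝ} {d e : ℕ} (h : DegLE f d) (hde : d ≤ e) : DegLE f e :=
  fun S hS => (h S hS).trans hde

lemma degLE_sum_chi {κ : Type*} {s : Finset κ} {a : κ → ℝ} {τ : κ → Finset ι} {d : ℕ}
    (h : ∀ k ∈ s, a k ≠ 0 → #(τ k) ≤ d) : DegLE (fun x => ∑ k ∈ s, a k * chi (τ k) x) d := by
  intro S hS
  rw [coeff_sum_chi] at hS
  obtain ⟨k, hk, hne⟩ := exists_ne_zero_of_sum_ne_zero hS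
  simp only [ne_eq, ite_eq_right_iff, Classical.not_imp] at hne
  rw [← hne.1]
  exact h k hk hne.2

lemma DegLE.add {f g : (ι → ℤˣ) → ℝ} {d : ℕ} (hf : DegLE f d) (hg : DegLE g d) :
    DegLE (fun x => f x + g x) d := by
  intro S hS
  rw [coeff_add] at hS
  by_cases h : coeff f S = 0
  · exact hg S (by simpa [h] using hS)
  · exact hf S h

lemma DegLE.const_mul {f : (ι → ℤˣ) → ℝ} {d : ℕ} (hf : DegLE f d) (a : ℝ) :
    DegLE (fun x => a * f x) d := by
  intro S hS
  rw [coeff_const_mul] at hS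
  exact hf S (right_ne_zero_of_mul hS)

lemma DegLE.sub {f g : (ι → ℤˣ) → ℝ} {d : ℕ} (hf : DegLE f d) (hg : DegLE g d) :
    DegLE (fun x => f x - g x) d := by
  simpa [sub_eq_add_neg] using hf.add (hg.const_mul (-1))

lemma degLE_chi (S : Finset ι) : DegLE (chi S) #S := by
  intro T hT
  rw [coeff_chi] at hT
  simp only [ne_eq, ite_eq_right_iff, one_ne_zero, imp_false, not_not] at hT
  rw [hT]

lemma degLE_const (a : ℝ) : DegLE (fun _ : ι → ℤˣ => a) 0 := by
  simpa using (degLE_chi (∅ : Finset ι)).const_mul a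

lemma DegLE.mul {f g : (ι → ℤˣ) → ℝ} {d e : ℕ} (hf : DegLE f d) (hg : DegLE g e) :
    DegLE (fun x => f x * g x) (d + e) := by
  have : (fun x => f x * g x) = fun x => ∑ p ∈ (univ : Finset (Finset ι × Finset ι)),
      (coeff f p.1 * coeff g p.2) * chi (p.1 ∆ p.2) x := by
    funext x
    rw [fourier f x, fourier g x, sum_mul_sum, ← sum_product']
    refine sum_congr rfl fun p _ => ?_
    rw [← chi_mul_chi]; ring
  rw [this]
  refine degLE_sum_chi fun p _ hp => ?_
  calc #(p.1 ∆ p.2) ≤ #(p.1 ∪ p.2) := card_le_card (by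
        intro i; simp only [mem_symmDiff, mem_union]; tauto)
    _ ≤ #p.1 + #p.2 := card_union_le _ _
    _ ≤ d + e := add_le_add (hf _ (left_ne_zero_of_mul hp)) (hg _ (right_ne_zero_of_mul hp))

lemma DegLE.prod {κ : Type*} (s : Finset κ) {f : κ → (ι → ℤˣ) → ℝ}
    (h : ∀ k ∈ s, DegLE (f k) 1) : DegLE (fun x => ∏ k ∈ s, f k x) #s := by
  classical
  induction s using Finset.induction_on with
  | empty => simpa using degLE_const (ι := ι) 1
  | insert k s hk ih =>
    simp only [prod_insert hk, card_insert_of_notMem hk]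
    rw [add_comm]
    exact (h k (mem_insert_self _ _)).mul (ih fun l hl => h l (mem_insert_of_mem hl))

lemma DegLE.apply_eq {f : (ι → ℤˣ) → ℝ} (hf : DegLE f 0) (x : ι → ℤˣ) : f x = coeff f ∅ := by
  rw [fourier f x, sum_eq_single ∅]
  · simp
  · intro S _ hS
    have : coeff f S = 0 := by
      by_contra h
      exact hS (by simpa using hf S h)
    simp [this]
  · simp

/-! ### Restrictions and derivatives -/

lemma expect_update (j : ι) (F : (ι → ℤˣ) → ℝ) :
    𝔼 x, F x = 𝔼 x, (F (update x j 1) + F (update x j (-1))) / 2 := by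
  have h : ∀ x : ι → ℤˣ, (F (update x j 1) + F (update x j (-1))) / 2 =
      (F x + F (flip {j} x)) / 2 := by
    intro x
    have hf : flip {j} x = update x j (-x j) := by
      funext i; by_cases h : i = j
      · subst h; simp [flip]
      · simp [flip, h]
    rcases Int.units_eq_one_or (x j) with hx | hx
    · rw [hf, hx]; nth_rewrite 3 [← update_eq_self j x]; rw [hx]
    · rw [hf, hx]; nth_rewrite 3 [← update_eq_self j x]; rw [hx, neg_neg, add_comm]
  simp only [h, ← expect_div, expect_add_distrib, expect_flip]
  ring

omit [Fintype ι] in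
lemma chi_piecewise (S H : Finset ι) (a x : ι → ℤˣ) :
    chi S (H.piecewise a x) = chi (S ∩ H) a * chi (S \ H) x := by
  rw [chi, ← sdiff_union_inter S H, prod_union (disjoint_sdiff_inter S H), mul_comm]
  congr 1
  · rw [chi, sdiff_union_inter]
    exact prod_congr rfl fun i hi => by rw [piecewise_eq_of_mem _ _ _ (mem_inter.mp hi).2]
  · rw [chi, sdiff_union_inter]
    exact prod_congr rfl fun i hi => by rw [piecewise_eq_of_notMem _ _ _ (mem_sdiff.mp hi).2]

/-- Restriction of `f` along the partial assignment of the values of `a` on `H`. -/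
def restr (H : Finset ι) (a : ι → ℤˣ) (f : (ι → ℤˣ) → ℝ) : (ι → ℤˣ) → ℝ :=
  fun x => f (H.piecewise a x)

lemma restr_eq_sum (H : Finset ι) (a : ι → ℤˣ) (f : (ι → ℤˣ) → ℝ) :
    restr H a f = fun x => ∑ S, (coeff f S * chi (S ∩ H) a) * chi (S \ H) x := by
  funext x
  rw [restr, fourier f]
  exact sum_congr rfl fun S _ => by rw [chi_piecewise]; ring

/-- The discrete derivative of `f` in direction `i`. -/
noncomputable def deriv (i : ι) (f : (ι → ℤˣ) → ℝ) : (ι → ℤˣ) → ℝ :=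
  fun x => (f (update x i 1) - f (update x i (-1))) / 2

omit [Fintype ι] in
lemma chi_update_of_notMem {S : Finset ι} {i : ι} (h : i ∉ S) (x : ι → ℤˣ) (b : ℤˣ) :
    chi S (update x i b) = chi S x :=
  prod_congr rfl fun j hj => by rw [update_of_ne (by rintro rfl; exact h hj)]

omit [Fintype ι] in
lemma chi_update_of_mem {S : Finset ι} {i : ι} (h : i ∈ S) (x : ι → ℤˣ) (b : ℤˣ) :
    chi S (update x i b) = ((b : ℤ) : ℝ) * chi (S.erase i) x := by
  rw [chi, ← mul_prod_erase S _ h]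
  simp only [update_self]
  congr 1
  exact chi_update_of_notMem (notMem_erase i S) x b

lemma deriv_eq_sum (i : ι) (f : (ι → ℤˣ) → ℝ) :
    deriv i f = fun x => ∑ S, (if i ∈ S then coeff f S else 0) * chi (S.erase i) x := by
  funext x
  rw [deriv, fourier f (update x i 1), fourier f (update x i (-1)), ← sum_sub_distrib, sum_div]
  refine sum_congr rfl fun S _ => ?_
  by_cases h : i ∈ S
  · rw [chi_update_of_mem h, chi_update_of_mem h]
    simp only [h, if_true]; push_cast; ring
  · rw [chi_update_of_notMem h, chi_update_of_notMem h]
    simp [h]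

lemma coeff_deriv (i : ι) (f : (ι → ℤˣ) → ℝ) (S : Finset ι) :
    coeff (deriv i f) S = if i ∈ S then 0 else coeff f (insert i S) := by
  rw [deriv_eq_sum, coeff_sum_chi]
  split_ifs with h
  · refine sum_eq_zero fun T _ => ?_
    rw [if_neg]
    rintro rfl
    exact notMem_erase i T h
  · rw [sum_eq_single (insert i S)]
    · simp [h]
    · intro T _ hT
      by_cases hi : i ∈ T
      · rw [if_neg]
        rintro rfl
        exact hT (insert_erase hi).symm
      · simp [hi]
    · simp

lemma DegLE.deriv {f : (ι → ℤˣ) → ℝ} {d : ℕ} (hf : DegLE f (d + 1)) (i : ι) :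
    DegLE (deriv i f) d := by
  intro S hS
  rw [coeff_deriv] at hS
  split_ifs at hS with h
  · exact absurd rfl hS
  · have := hf _ hS
    rw [card_insert_of_notMem h] at this
    omega

omit [Fintype ι] in
-- For sign-valued `f` this square is the indicator of sensitivity in direction `i`, so its
-- expectation is the influence.
lemma deriv_sq (i : ι) (f : (ι → ℤˣ) → ℝ) (x : ι → ℤˣ) :
    deriv i f x ^ 2 = ((f x - f (flip {i} x)) / 2) ^ 2 := by
  have hf : flip {i} x = update x i (-x i) := by
    funext j; by_cases h : j = i
    · subst h; simp [flip]
    · simp [flip, h]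
  rw [hf, deriv]
  rcases Int.units_eq_one_or (x i) with hx | hx
  · rw [hx]; nth_rewrite 3 [← update_eq_self i x]; rw [hx]
  · rw [hx, neg_neg]; nth_rewrite 3 [← update_eq_self i x]; rw [hx]; ring

omit [Fintype ι] in
lemma deriv_restr_of_mem {i : ι} {H : Finset ι} (h : i ∈ H) (a : ι → ℤˣ) (f : (ι → ℤˣ) → ℝ) :
    deriv i (restr H a f) = fun _ => 0 := by
  funext x
  have : ∀ b, H.piecewise a (update x i b) = H.piecewise a x := by
    intro b; funext j
    by_cases hj : j ∈ H
    · simp [hj]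
    · simp only [piecewise_eq_of_notMem _ _ _ hj]
      rw [update_of_ne (by rintro rfl; exact hj h)]
  simp [deriv, restr, this]

omit [Fintype ι] in
lemma deriv_restr_of_notMem {i : ι} {H : Finset ι} (h : i ∉ H) (a : ι → ℤˣ)
    (f : (ι → ℤˣ) → ℝ) : deriv i (restr H a f) = restr H a (deriv i f) := by
  funext x
  have : ∀ b, H.piecewise a (update x i b) = update (H.piecewise a x) i b := by
    intro b; funext j
    by_cases hj : j = i
    · subst hj; simp [h]
    · by_cases hj' : j ∈ H <;> simp [hj, hj']
  simp [deriv, restr, this]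

lemma expect_restr (H : Finset ι) (f : (ι → ℤˣ) → ℝ) : 𝔼 a, 𝔼 x, restr H a f x = 𝔼 x, f x := by
  simp only [restr_eq_sum]
  rw [expect_comm]
  have : ∀ x : ι → ℤˣ, 𝔼 a : ι → ℤˣ, ∑ S, (coeff f S * chi (S ∩ H) a) * chi (S \ H) x =
      ∑ S, (coeff f S * if S ∩ H = ∅ then 1 else 0) * chi (S \ H) x := by
    intro x
    rw [expect_sum_comm]
    refine sum_congr rfl fun S _ => ?_
    rw [← expect_mul, ← mul_expect, expect_chi]
  simp only [this]
  rw [expect_sum_comm]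
  simp only [← mul_expect, expect_chi]
  rw [sum_eq_single ∅]
  · simp [coeff]
  · intro S _ hS
    by_cases h1 : S ∩ H = ∅
    · have h2 : S \ H ≠ ∅ := by
        intro h2
        apply hS
        rw [← sdiff_union_inter S H, h1, h2]; simp
      simp [h2]
    · simp [h1]
  · simp

end Fourier

/-! ### The weight `2^(-deg)` and sums over subcubes. -/

section Omega

variable {ι : Type*} [Fintype ι] [DecidableEq ι]

open Classical in
/-- The degree of `f` as a polynomial (`0` for `f = 0`). -/
noncomputable def deg (f : (ι → ℤˣ) → ℝ) : ℕ := (univ.filter fun S => coeff f S ≠ 0).sup card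

open Classical in
/-- The weight `2 ^ (-deg f)`, or `0` if `f = 0`. -/
noncomputable def omega (f : (ι → ℤˣ) → ℝ) : ℝ :=
  if ∀ x, f x = 0 then 0 else (1 / 2) ^ deg f

lemma degLE_deg (f : (ι → ℤˣ) → ℝ) : DegLE f (deg f) := fun S hS =>
  le_sup (f := card) (by simpa using hS)

lemma deg_le {f : (ι → ℤˣ) → ℝ} {d : ℕ} (h : DegLE f d) : deg f ≤ d :=
  Finset.sup_le fun S hS => h S (by simpa using hS)

lemma exists_coeff_ne_zero {f : (ι → ℤˣ) → ℝ} (h : ¬ ∀ x, f x = 0) :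
    ∃ S, coeff f S ≠ 0 ∧ #S = deg f := by
  classical
  rw [← coeff_eq_zero_iff] at h
  push Not at h
  obtain ⟨S, hS⟩ := h
  obtain ⟨T, hT, h⟩ := exists_mem_eq_sup (univ.filter fun S => coeff f S ≠ 0)
    ⟨S, by simpa using hS⟩ card
  exact ⟨T, by simpa using hT, h.symm⟩

lemma omega_of_zero {f : (ι → ℤˣ) → ℝ} (h : ∀ x, f x = 0) : omega f = 0 := if_pos h

lemma omega_of_ne {f : (ι → ℤˣ) → ℝ} (h : ¬ ∀ x, f x = 0) : omega f = (1 / 2) ^ deg f := if_neg h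

lemma omega_nonneg (f : (ι → ℤˣ) → ℝ) : 0 ≤ omega f := by
  unfold omega; split_ifs <;> positivity

lemma le_omega {f : (ι → ℤˣ) → ℝ} {d : ℕ} (h : ¬ ∀ x, f x = 0) (hd : DegLE f d) :
    (1 / 2 : ℝ) ^ d ≤ omega f := by
  rw [omega_of_ne h]
  exact pow_le_pow_of_le_one (by norm_num) (by norm_num) (deg_le hd)

lemma omega_le {f : (ι → ℤˣ) → ℝ} {S : Finset ι} (h : coeff f S ≠ 0) :
    omega f ≤ (1 / 2) ^ #S := by
  rw [omega_of_ne fun h0 => h ((coeff_eq_zero_iff f).mpr h0 S)]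
  exact pow_le_pow_of_le_one (by norm_num) (by norm_num) (degLE_deg f S h)

lemma omega_le_one (f : (ι → ℤˣ) → ℝ) : omega f ≤ 1 := by
  unfold omega; split_ifs
  · norm_num
  · exact pow_le_one₀ (by norm_num) (by norm_num)

/-- Fixing one coordinate. -/
lemma coeff_update (g : (ι → ℤˣ) → ℝ) (j : ι) (b : ℤˣ) (S : Finset ι) :
    coeff (fun x => g (update x j b)) S =
      if j ∈ S then 0 else coeff g S + ((b : ℤ) : ℝ) * coeff g (insert j S) := by
  have h1 : (fun x => g (update x j b)) = fun x => ∑ T,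
      (coeff g T * if j ∈ T then ((b : ℤ) : ℝ) else 1) * chi (T.erase j) x := by
    funext x
    rw [fourier g]
    refine sum_congr rfl fun T _ => ?_
    by_cases h : j ∈ T
    · rw [chi_update_of_mem h]; simp only [h, if_true]; ring
    · rw [chi_update_of_notMem h, erase_eq_of_notMem h]; simp [h]
  rw [h1, coeff_sum_chi]
  split_ifs with h
  · refine sum_eq_zero fun T _ => ?_
    rw [if_neg]
    rintro rfl
    exact notMem_erase j T h
  · have hne : S ≠ insert j S := fun h' => h (h' ▸ mem_insert_self j S)
    rw [← sum_subset (subset_univ {S, insert j S}), sum_pair hne]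
    · simp [h, mul_comm]
    · intro T _ hT
      rw [if_neg]
      rintro rfl
      by_cases hj : j ∈ T
      · exact hT (by simp [insert_erase hj])
      · exact hT (by simp [erase_eq_of_notMem hj])

/-- Restriction does not raise the degree, which settles the case of two nonzero halves. If one half
vanishes, `g` is a multiple of a linear factor in `x j`, so the other half has degree at most `deg g
- 1`; its weight is at least doubled and pays for the missing half. -/
lemma omega_le_update (g : (ι → ℤˣ) → ℝ) (j : ι) :
    omega g ≤ (omega (fun x => g (update x j 1)) + omega (fun x => g (update x j (-1)))) / 2 := by
  by_cases h0 : ∀ x, g x = 0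
  · rw [omega_of_zero h0]
    linarith [omega_nonneg fun x => g (update x j 1), omega_nonneg fun x => g (update x j (-1))]
  have hdeg : ∀ b : ℤˣ, DegLE (fun x => g (update x j b)) (deg g) := by
    intro b S hS
    rw [coeff_update] at hS
    split_ifs at hS with h
    · exact absurd rfl hS
    · by_cases h1 : coeff g S = 0
      · have h2 : coeff g (insert j S) ≠ 0 := by
          intro h2; simp [h1, h2] at hS
        exact (card_le_card (subset_insert j S)).trans (degLE_deg g _ h2)
      · exact degLE_deg g _ h1
  have main : ∀ b : ℤˣ, (∀ x, g (update x j (-b)) = 0) →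
      2 * omega g ≤ omega (fun x => g (update x j b)) := by
    intro b hb
    have hrel : ∀ S, j ∉ S → coeff g S = ((b : ℤ) : ℝ) * coeff g (insert j S) := by
      intro S hS
      have h1 := (coeff_eq_zero_iff _).mpr hb S
      rw [coeff_update, if_neg hS] at h1
      push_cast at h1
      linarith
    have hne : ¬ ∀ x, g (update x j b) = 0 := by
      intro h
      apply h0
      intro x
      rw [← update_eq_self j x]
      rcases Int.units_eq_one_or (x j) with hx | hx <;>
        rcases Int.units_eq_one_or b with hb' | hb' <;> subst hb' <;> rw [hx] <;>
        first | exact h x | exact hb x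
    obtain ⟨S, hS, hcard⟩ := exists_coeff_ne_zero h0
    have hlow : ∀ S, j ∉ S → coeff g S ≠ 0 → #S + 1 ≤ deg g := by
      intro S hS h
      rw [hrel S hS] at h
      have := degLE_deg g _ (right_ne_zero_of_mul h)
      rwa [card_insert_of_notMem hS] at this
    have hpos : 1 ≤ deg g := by
      by_cases hj : j ∈ S
      · rw [← hcard]; exact card_pos.mpr ⟨j, hj⟩
      · have := hlow S hj hS; omega
    have hd : DegLE (fun x => g (update x j b)) (deg g - 1) := by
      intro S hS
      rw [coeff_update] at hS
      split_ifs at hS with h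
      · exact absurd rfl hS
      · have h1 : coeff g S ≠ 0 := by
          intro h1
          rw [← hrel S h, h1] at hS
          simp at hS
        have := hlow S h h1
        omega
    have h2 := le_omega hne hd
    have h3 : (1 / 2 : ℝ) ^ (deg g - 1) = 2 * (1 / 2) ^ deg g := by
      obtain ⟨m, hm⟩ : ∃ m, deg g = m + 1 := ⟨deg g - 1, by omega⟩
      rw [hm, pow_succ]; simp only [Nat.add_sub_cancel]; ring
    rw [omega_of_ne h0, ← h3]
    exact h2
  by_cases hm : ∀ x, g (update x j (-1)) = 0
  · have := main 1 hm
    rw [omega_of_zero hm]; linarith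
  by_cases hp : ∀ x, g (update x j 1) = 0
  · have := main (-1) (by simpa using hp)
    rw [omega_of_zero hp]; linarith
  have h1 := le_omega hp (hdeg 1)
  have h2 := le_omega hm (hdeg (-1))
  rw [omega_of_ne h0]
  linarith

/-- The one-coordinate inequality iterated: `omega` is a submartingale under random restriction. -/
lemma omega_le_expect_restr (H : Finset ι) (g : (ι → ℤˣ) → ℝ) :
    omega g ≤ 𝔼 a, omega (restr H a g) := by
  induction H using Finset.induction_on generalizing g with
  | empty =>
    have : ∀ a, restr ∅ a g = g := fun a => by funext x; simp [restr]
    simp [this]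
  | insert j H hj ih =>
    have h1 : ∀ a : ι → ℤˣ, restr (insert j H) a g = restr H a (fun x => g (update x j (a j))) := by
      intro a; funext x
      simp [restr, piecewise_insert]
    have h2 : ∀ (a : ι → ℤˣ) (b c : ℤˣ), restr H (update a j b) (fun x => g (update x j c)) =
        restr H a (fun x => g (update x j c)) := by
      intro a b c; funext x
      have : H.piecewise (update a j b) x = H.piecewise a x := by
        funext i
        by_cases hi : i ∈ H
        · simp only [piecewise_eq_of_mem _ _ _ hi]
          rw [update_of_ne (by rintro rfl; exact hj hi)]
        · simp [hi]
      simp [restr, this]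
    rw [expect_update j]
    simp only [h1, update_self, h2, ← expect_div, expect_add_distrib]
    exact (omega_le_update g j).trans (by gcongr <;> exact ih _)

open Classical in
/-- A nonzero polynomial of degree `d` is nonzero on at least a `2 ^ (-d)` fraction of the cube. -/
lemma omega_le_expect (g : (ι → ℤˣ) → ℝ) : omega g ≤ 𝔼 x, if g x = 0 then 0 else 1 := by
  refine (omega_le_expect_restr univ g).trans (expect_le_expect fun a _ => ?_)
  split_ifs with h
  · rw [omega_of_zero]
    intro x; simpa [restr] using h
  · exact omega_le_one _

/-- The sum of `h` over the subcube through `x` spanned by the directions in `K`. -/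
noncomputable def cubeSum (K : Finset ι) (h : (ι → ℤˣ) → ℝ) : (ι → ℤˣ) → ℝ :=
  fun x => ∑ T ∈ K.powerset, h (flip T x)

lemma expect_cubeSum (K : Finset ι) (h : (ι → ℤˣ) → ℝ) :
    𝔼 x, cubeSum K h x = 2 ^ #K * 𝔼 x, h x := by
  simp only [cubeSum, expect_sum_comm, expect_flip]
  simp

omit [Fintype ι] in
lemma cubeSum_flip {K T : Finset ι} (hT : T ⊆ K) (h : (ι → ℤˣ) → ℝ) (x : ι → ℤˣ) :
    cubeSum K h (flip T x) = cubeSum K h x := by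
  unfold cubeSum
  refine sum_nbij' (fun S => S ∆ T) (fun S => S ∆ T) ?_ ?_ ?_ ?_ ?_
  · intro S hS
    rw [mem_powerset] at hS ⊢
    exact (symmDiff_le_sup (a := S) (b := T)).trans (union_subset hS hT)
  · intro S hS
    rw [mem_powerset] at hS ⊢
    exact (symmDiff_le_sup (a := S) (b := T)).trans (union_subset hS hT)
  · intro S _; simp
  · intro S _; simp
  · intro S _; rw [flip_symmDiff]

omit [Fintype ι] in
lemma cubeSum_chi (K R : Finset ι) (x : ι → ℤˣ) :
    cubeSum K (chi R) x = if Disjoint R K then 2 ^ #K * chi R x else 0 := by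
  simp only [cubeSum, chi_flip, ← sum_mul]
  rw [← prod_one_add]
  split_ifs with h
  · congr 1
    rw [prod_congr rfl (g := fun _ => (2 : ℝ))]
    · simp
    · intro i hi
      rw [if_neg (fun hR => disjoint_left.mp h hR hi)]; norm_num
  · obtain ⟨i, hR, hK⟩ := not_disjoint_iff.mp h
    rw [prod_eq_zero hK, zero_mul]
    simp [hR]

/-- Summing against `chi A` over subcubes in the directions of `K` keeps only the monomials that
meet `K` exactly in `A`, and strips `A` off them. Hence for `g` of degree at most `#K` the signed
sum against `chi K` is constant, and against `chi (K.erase u)` it is affine. The structure arguments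
below rest on these two facts. -/
lemma cubeSum_mul_chi (K A : Finset ι) (hA : A ⊆ K) (g : (ι → ℤˣ) → ℝ) :
    cubeSum K (fun x => g x * chi A x) = fun x => ∑ S,
      (if S ∩ K = A then 2 ^ #K * coeff g S else 0) * chi (S \ A) x := by
  funext x
  have h1 : cubeSum K (fun x => g x * chi A x) x =
      ∑ S, coeff g S * cubeSum K (chi (S ∆ A)) x := by
    simp only [cubeSum, mul_sum]
    rw [sum_comm]
    refine sum_congr rfl fun T _ => ?_
    rw [fourier g, sum_mul]
    exact sum_congr rfl fun S _ => by rw [mul_assoc, chi_mul_chi]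
  rw [h1]
  refine sum_congr rfl fun S _ => ?_
  rw [cubeSum_chi]
  by_cases h : S ∩ K = A
  · have hd : Disjoint (S ∆ A) K := by
      rw [disjoint_left]
      intro i hi hK
      rw [mem_symmDiff, ← h] at hi
      simp only [mem_inter, hK, and_true] at hi
      tauto
    have he : S ∆ A = S \ A := by
      have : A ⊆ S := h ▸ inter_subset_left
      ext i
      simp only [mem_symmDiff, mem_sdiff]
      have := @this i
      tauto
    rw [if_pos hd, if_pos h, he]; ring
  · have hd : ¬ Disjoint (S ∆ A) K := by
      intro hd
      apply h
      ext i
      rw [disjoint_left] at hd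
      have h1 := @hd i
      rw [mem_symmDiff] at h1
      have h2 := @hA i
      simp only [mem_inter]
      tauto
    rw [if_neg hd, if_neg h]; ring

lemma DegLE.cubeSum_mul_chi {g : (ι → ℤˣ) → ℝ} {d e : ℕ} {K A : Finset ι} (hg : DegLE g d)
    (hA : A ⊆ K) (hd : d ≤ #A + e) : DegLE (cubeSum K (fun x => g x * chi A x)) e := by
  rw [HypercubeStable.cubeSum_mul_chi K A hA]
  refine degLE_sum_chi fun S _ h => ?_
  split_ifs at h with h1
  · have h2 := hg S (right_ne_zero_of_mul h)
    have h3 : A ⊆ S := h1 ▸ inter_subset_left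
    have := card_sdiff_of_subset h3
    have := card_le_card h3
    omega
  · exact absurd rfl h

lemma cubeSum_mul_chi_top {g : (ι → ℤˣ) → ℝ} {K : Finset ι} (hg : DegLE g #K) (x : ι → ℤˣ) :
    cubeSum K (fun x => g x * chi K x) x = 2 ^ #K * coeff g K := by
  rw [(hg.cubeSum_mul_chi (e := 0) subset_rfl (by simp)).apply_eq x,
    cubeSum_mul_chi K K subset_rfl, coeff_sum_chi, sum_eq_single K]
  · simp
  · intro S _ hS
    split_ifs with h1 h2
    · exact absurd (subset_antisymm (sdiff_eq_empty_iff_subset.mp h1) (inter_eq_right.mp h2)) hS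
    · rfl
    · rfl
  · simp

end Omega

/-! ### The gap in the support density of ternary polynomials. -/

section Gap

variable {ι : Type*} [Fintype ι] [DecidableEq ι]

/-- `h` only takes the values `-1`, `0` and `1`. -/
def IsTernary {α : Type*} (h : α → ℝ) : Prop := ∀ x, h x = -1 ∨ h x = 0 ∨ h x = 1

lemma IsTernary.sq_eq {α : Type*} {h : α → ℝ} (hh : IsTernary h) [DecidableEq ℝ] (x : α) :
    h x ^ 2 = if h x = 0 then 0 else 1 := by
  rcases hh x with h | h | h <;> simp [h]

lemma IsTernary.exists_int_sum {α : Type*} {h : α → ℝ} (hh : IsTernary h) (s : Finset α) :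
    ∃ (z : ℤ) (w : ℕ), ∑ x ∈ s, h x = z ∧ ∑ x ∈ s, h x ^ 2 = w ∧ |z| ≤ w ∧ (2 : ℤ) ∣ w - z := by
  classical
  induction s using Finset.induction_on with
  | empty => exact ⟨0, 0, by simp⟩
  | insert a s ha ih =>
    obtain ⟨z, w, h1, h2, h3, h4⟩ := ih
    simp only [sum_insert ha, h1, h2]
    rcases hh a with h | h | h
    · exact ⟨z - 1, w + 1, by rw [h]; push_cast; ring, by rw [h]; push_cast; ring,
        by rw [abs_le] at *; push_cast; omega, by push_cast; omega⟩
    · exact ⟨z, w, by rw [h]; ring, by rw [h]; ring, h3, h4⟩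
    · exact ⟨z + 1, w + 1, by rw [h]; push_cast; ring, by rw [h]; push_cast; ring,
        by rw [abs_le] at *; push_cast; omega, by push_cast; omega⟩

lemma unit_sq (u : ℤˣ) : ((u : ℤ) : ℝ) ^ 2 = 1 := by rw [sq, unit_mul_self]

omit [Fintype ι] [DecidableEq ι] in
lemma chi_eq_or (S : Finset ι) (x : ι → ℤˣ) : chi S x = 1 ∨ chi S x = -1 := by
  classical
  have := chi_mul_self S x
  rcases mul_self_eq_one_iff.mp this with h | h <;> simp [h]

omit [Fintype ι] [DecidableEq ι] in
lemma IsTernary.mul_chi {g : (ι → ℤˣ) → ℝ} (hg : IsTernary g) (A : Finset ι) :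
    IsTernary fun x => g x * chi A x := by
  intro x
  rcases hg x with h | h | h <;> rcases chi_eq_or A x with h' | h' <;> simp [h, h']

lemma omega_le_expect_sq {g : (ι → ℤˣ) → ℝ} (hg : IsTernary g) : omega g ≤ 𝔼 x, g x ^ 2 := by
  classical
  refine (omega_le_expect g).trans (le_of_eq (expect_congr rfl fun x _ => ?_))
  rw [hg.sq_eq]

omit [Fintype ι] in
/-- The ternary functions `∏ u ∈ K, (x u + φ u x) / 2`, with each `φ u` a sign not depending on the
coordinates in `K`, have at most one nonzero value on each subcube in the directions of `K`. -/
lemma cubeSum_prod_le_one [DecidableEq ℝ] {K : Finset ι} {φ : ι → (ι → ℤˣ) → ℝ} {c : ℝ}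
    (hφ : ∀ u ∈ K, ∀ x, φ u x ^ 2 = 1)
    (hinv : ∀ u ∈ K, ∀ T ⊆ K, ∀ x, φ u (flip T x) = φ u x) (x : ι → ℤˣ) :
    cubeSum K (fun x => if c * ∏ u ∈ K, ((((x u : ℤ) : ℝ) + φ u x) / 2) = 0 then 0 else 1) x
      ≤ 1 := by
  have h1 : ∀ T ⊆ K, c * ∏ u ∈ K, ((((flip T x u : ℤ) : ℝ) + φ u (flip T x)) / 2) ≠ 0 →
      ∀ u ∈ K, (((flip T x u : ℤ)) : ℝ) = φ u x := by
    intro T hT h u hu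
    have h2 := prod_ne_zero_iff.mp (right_ne_zero_of_mul h) u hu
    rw [hinv u hu T hT] at h2
    have h3 := unit_sq (flip T x u)
    have h4 := hφ u hu x
    have h5 : ((((flip T x u : ℤ)) : ℝ) - φ u x) * ((((flip T x u : ℤ)) : ℝ) + φ u x) = 0 := by
      linear_combination h3 - h4
    rcases mul_eq_zero.mp h5 with h6 | h6
    · linarith
    · exact absurd (by rw [h6]; simp) h2
  rw [cubeSum, sum_ite, sum_const_zero, zero_add, sum_const, nsmul_eq_mul, mul_one]
  refine Nat.cast_le_one.mpr (card_le_one.mpr ?_)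
  intro S hS T hT
  simp only [mem_filter, mem_powerset] at hS hT
  ext i
  by_cases hi : i ∈ K
  · have h2 := (h1 S hS.1 hS.2 i hi).trans (h1 T hT.1 hT.2 i hi).symm
    have h3 : flip S x i = flip T x i := by exact_mod_cast h2
    simp only [flip] at h3
    by_cases hs : i ∈ S <;> by_cases ht : i ∈ T <;> simp_all [units_ne_neg_self]
  · exact ⟨fun h => absurd (hS.1 h) hi, fun h => absurd (hT.1 h) hi⟩

/-- A ternary polynomial of degree `d` whose support has density greater than `2 ^ (-d)` has support
of density at least `3 / 2 * 2 ^ (-d)`. -/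
lemma omega_gap {g : (ι → ℤˣ) → ℝ} (hg : IsTernary g) :
    𝔼 x, g x ^ 2 = omega g ∨ 3 / 2 * omega g ≤ 𝔼 x, g x ^ 2 := by
  classical
  by_cases h0 : ∀ x, g x = 0
  · left; simp [h0, omega_of_zero h0]
  obtain ⟨K, hK, hKd⟩ := exists_coeff_ne_zero h0
  have hdeg : DegLE g #K := hKd ▸ degLE_deg g
  have hω : omega g = (1 / 2) ^ #K := by rw [omega_of_ne h0, hKd]
  have hcancel : (1 / 2 : ℝ) ^ #K * 2 ^ #K = 1 := by rw [← mul_pow]; norm_num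
  -- `n x` counts the support points of `g` in the `K`-subcube through `x`; in this scale `omega g`
  -- corresponds to average `1`.
  set n : (ι → ℤˣ) → ℝ := cubeSum K fun x => g x ^ 2 with hn
  have hEn : 𝔼 x, n x = 2 ^ #K * 𝔼 x, g x ^ 2 := expect_cubeSum _ _
  suffices h : 𝔼 x, n x ≤ 1 ∨ 3 / 2 ≤ 𝔼 x, n x by
    have hp : (0 : ℝ) < (1 / 2) ^ #K := by positivity
    have h2 : 𝔼 x, g x ^ 2 = (1 / 2) ^ #K * 𝔼 x, n x := by rw [hEn, ← mul_assoc, hcancel, one_mul]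
    rcases h with h | h
    · left
      refine le_antisymm ?_ (omega_le_expect_sq hg)
      rw [hω, h2]; nlinarith
    · right
      rw [hω, h2]; nlinarith
  have hint : ∀ x A, ∃ (z : ℤ) (w : ℕ), cubeSum K (fun x => g x * chi A x) x = z ∧ n x = w ∧
      |z| ≤ w ∧ (2 : ℤ) ∣ w - z := by
    intro x A
    obtain ⟨z, w, h1, h2, h3⟩ := IsTernary.exists_int_sum (h := fun T => g (flip T x) *
      chi A (flip T x)) (fun T => hg.mul_chi A (flip T x)) K.powerset
    refine ⟨z, w, h1, ?_, h3⟩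
    rw [← h2, hn, cubeSum]
    refine sum_congr rfl fun T _ => ?_
    rw [mul_pow, sq (chi A _), chi_mul_self, mul_one]
  set ε : ℝ := 2 ^ #K * coeff g K with hε
  have hεx : ∀ x, cubeSum K (fun x => g x * chi K x) x = ε := cubeSum_mul_chi_top hdeg
  have hε0 : ε ≠ 0 := mul_ne_zero (by positivity) hK
  obtain ⟨e, -, he, -⟩ := hint 1 K
  rw [hεx] at he
  have he0 : e ≠ 0 := by rintro rfl; exact hε0 (by simpa using he)
  -- `n` is bounded below by the constant signed sum, so `|e| ≥ 2` already gives average at least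
  -- `2`.
  by_cases he2 : 2 ≤ |e|
  · right
    have : ∀ x, 2 ≤ n x := by
      intro x
      obtain ⟨z, w, h1, h2, h3, -⟩ := hint x K
      rw [hεx, he] at h1
      have h1 : e = z := by exact_mod_cast h1
      subst h1
      rw [h2]
      exact_mod_cast he2.trans h3
    calc (3 / 2 : ℝ) ≤ 2 := by norm_num
      _ ≤ _ := le_expect univ_nonempty fun x _ => this x
  have he1 : |e| = 1 := by
    have := abs_pos.mpr he0
    omega
  have hεsq : ε * ε = 1 := by
    rw [he]; have := abs_mul_abs_self e; rw [he1] at this; exact_mod_cast this.symm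
  -- All signed sums have the parity of `n x`, and one of them is `±1`.
  have hodd : ∀ x A, ∃ (z : ℤ) (w : ℕ), cubeSum K (fun x => g x * chi A x) x = z ∧ n x = w ∧
      |z| ≤ w ∧ z % 2 = 1 ∧ w % 2 = 1 := by
    intro x A
    obtain ⟨z', w', h1, h2, h3, h4⟩ := hint x K
    rw [hεx, he] at h1
    have h1 : e = z' := by exact_mod_cast h1
    subst h1
    obtain ⟨z, w, h5, h6, h7, h8⟩ := hint x A
    have : w = w' := by rw [h2] at h6; exact_mod_cast h6.symm
    subst this
    refine ⟨z, w, h5, h6, h7, ?_, ?_⟩ <;> rcases abs_eq (zero_le_one) |>.mp he1 with h | h <;> omega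
  have hn1 : ∀ x, 1 ≤ n x := by
    intro x
    obtain ⟨z, w, -, h2, -, -, h5⟩ := hodd x K
    rw [h2]
    exact_mod_cast (show 1 ≤ w by omega)
  have hn3 : ∀ x, n x ≠ 1 → 3 ≤ n x := by
    intro x hx
    obtain ⟨z, w, -, h2, -, -, h5⟩ := hodd x K
    rw [h2] at hx ⊢
    have : w ≠ 1 := by rintro rfl; simp at hx
    exact_mod_cast (show 3 ≤ w by omega)
  set γ : ι → (ι → ℤˣ) → ℝ := fun u => cubeSum K (fun x => g x * chi (K.erase u) x) with hγ
  have hγdeg : ∀ u ∈ K, DegLE (γ u) 1 := fun u hu =>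
    hdeg.cubeSum_mul_chi (erase_subset u K) (by rw [card_erase_add_one hu])
  -- `γ u ^ 2 - 1` has degree at most `2`, so if it is not identically zero it is nonzero on at
  -- least a quarter of the points. There `n ≥ 3`, and the average of `n` is at least `1 + 2/4`.
  by_cases hγ1 : ∃ u ∈ K, ∃ x, γ u x ^ 2 ≠ 1
  · right
    obtain ⟨u, hu, x₀, hx₀⟩ := hγ1
    have hq : DegLE (fun x => γ u x * γ u x - 1) 2 :=
      ((hγdeg u hu).mul (hγdeg u hu)).sub ((degLE_const 1).mono (by norm_num))
    have h1 := (le_omega (fun h => hx₀ (by have := h x₀; rw [sq]; linarith)) hq).trans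
      (omega_le_expect _)
    have h2 : ∀ x, 1 + 2 * (if γ u x * γ u x - 1 = 0 then 0 else 1) ≤ n x := by
      intro x
      split_ifs with h
      · simpa using hn1 x
      · have : n x ≠ 1 := by
          obtain ⟨z, w, h1, h2, h3, h4, -⟩ := hodd x (K.erase u)
          rw [h2]
          intro hw
          have hw : w = 1 := by exact_mod_cast hw
          subst hw
          apply h
          change γ u x = z at h1
          rw [h1]
          have : z = 1 ∨ z = -1 := by rw [abs_le] at h3; push_cast at h3; omega
          rcases this with h | h <;> subst h <;> norm_num
        linarith [hn3 x this]
    have h3 := expect_le_expect (s := univ) fun x _ => h2 x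
    rw [expect_add_distrib, expect_const univ_nonempty, ← mul_expect] at h3
    linarith
  push Not at hγ1
  set φ : ι → (ι → ℤˣ) → ℝ := fun u x => ε * γ u x with hφ
  have hφsq : ∀ u ∈ K, ∀ x, φ u x ^ 2 = 1 := by
    intro u hu x
    rw [hφ]; simp only [mul_pow, hγ1 u hu x, sq ε, hεsq, one_mul]
  have hφinv : ∀ u ∈ K, ∀ T ⊆ K, ∀ x, φ u (flip T x) = φ u x := by
    intro u _ T hT x
    simp only [hφ, hγ, cubeSum_flip hT]
  -- The candidate of minimal support: its only support point in a subcube has coordinates `φ u`,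
  -- and its value there reproduces the signed sum `ε`.
  set g' : (ι → ℤˣ) → ℝ := fun x => ε * ∏ u ∈ K, ((((x u : ℤ) : ℝ) + φ u x) / 2) with hg'
  have hg'deg : DegLE g' #K := by
    refine (DegLE.prod K fun u hu => ?_).const_mul ε
    have h1 : DegLE (fun x : ι → ℤˣ => (((x u : ℤ)) : ℝ)) 1 := by
      have := degLE_chi ({u} : Finset ι)
      rw [card_singleton] at this
      refine (show (fun x : ι → ℤˣ => (((x u : ℤ)) : ℝ)) = chi {u} from ?_) ▸ this
      funext x; simp [chi]
    have h2 := (h1.add ((hγdeg u hu).const_mul ε)).const_mul (1 / 2)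
    refine (show (fun x : ι → ℤˣ => (((x u : ℤ) : ℝ) + φ u x) / 2) = _ from ?_) ▸ h2
    funext x; simp only [hφ]; ring
  have hsupp := cubeSum_prod_le_one (c := ε) hφsq hφinv
  have hone : ∀ x, n x = 1 → g x = g' x := by
    intro x hx
    obtain ⟨T₀, hT₀, hne⟩ : ∃ T ∈ K.powerset, g (flip T x) ^ 2 ≠ 0 :=
      exists_ne_zero_of_sum_ne_zero (by rw [hn, cubeSum] at hx; rw [hx]; exact one_ne_zero)
    have hsq1 : g (flip T₀ x) ^ 2 = 1 := by
      rw [hg.sq_eq] at hne ⊢; split_ifs at hne ⊢ <;> simp_all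
    have hoth : ∀ T ∈ K.powerset, T ≠ T₀ → g (flip T x) = 0 := by
      intro T hT hTne
      have h1 : ∑ T ∈ K.powerset, g (flip T x) ^ 2 = 1 := hx
      rw [← add_sum_erase _ _ hT₀, hsq1] at h1
      have h2 := (sum_eq_zero_iff_of_nonneg fun T _ => sq_nonneg (g (flip T x))).mp
        (show ∑ T ∈ K.powerset.erase T₀, g (flip T x) ^ 2 = 0 by linarith) T
        (mem_erase.mpr ⟨hTne, hT⟩)
      exact pow_eq_zero_iff (two_ne_zero) |>.mp h2
    have hval : ∀ A, cubeSum K (fun x => g x * chi A x) x = g (flip T₀ x) * chi A (flip T₀ x) := by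
      intro A
      rw [cubeSum, sum_eq_single T₀]
      · intro T hT hTne; rw [hoth T hT hTne, zero_mul]
      · intro h; exact absurd hT₀ h
    have hεv : ε = g (flip T₀ x) * chi K (flip T₀ x) := by rw [← hεx x, hval]
    have hφv : ∀ u ∈ K, φ u x = ((flip T₀ x u : ℤ) : ℝ) := by
      intro u hu
      simp only [hφ, hγ, hval, hεv]
      have h1 : chi K (flip T₀ x) = ((flip T₀ x u : ℤ) : ℝ) * chi (K.erase u) (flip T₀ x) := by
        rw [chi, ← mul_prod_erase K _ hu]; rfl
      rw [h1]
      linear_combination ((flip T₀ x u : ℤ) : ℝ) * (chi (K.erase u) (flip T₀ x)) ^ 2 * hsq1 +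
        ((flip T₀ x u : ℤ) : ℝ) * chi_mul_self (K.erase u) (flip T₀ x)
    by_cases hT0 : T₀ = ∅
    · subst hT0
      rw [flip_empty] at hφv hεv
      have : g' x = ε * chi K x := by
        simp only [hg', chi]
        congr 1
        exact prod_congr rfl fun u hu => by rw [hφv u hu]; ring
      rw [this, hεv, mul_assoc, chi_mul_self, mul_one]
    · obtain ⟨u, hu⟩ := nonempty_iff_ne_empty.mpr hT0
      have huK := mem_powerset.mp hT₀ hu
      have h1 : g' x = 0 := by
        simp only [hg']
        rw [prod_eq_zero huK, mul_zero]
        rw [hφv u huK, flip_apply, if_pos hu]; push_cast; ring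
      rw [h1]
      have := hoth ∅ (empty_mem_powerset K) (Ne.symm hT0)
      rwa [flip_empty] at this
  by_cases hδ : ∀ x, g x - g' x = 0
  · left
    have : ∀ x, n x ≤ 1 := by
      intro x
      refine le_trans (le_of_eq ?_) (hsupp x)
      rw [hn]
      refine sum_congr rfl fun T _ => ?_
      have := hδ (flip T x)
      rw [sub_eq_zero] at this
      change g (flip T x) ^ 2 = if g' (flip T x) = 0 then 0 else 1
      rw [hg.sq_eq, this]
    exact expect_le univ_nonempty fun x _ => this x
  · right
    -- By degree, `g` and `g'` differ in at least one point per subcube on average. They agree where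
    -- `n = 1`; elsewhere they differ in at most `n + 1 ≤ 2 * (n - 1)` points, since `n ≥ 3`. So `1
    -- ≤ 2 * (𝔼 n - 1)`.
    have hδdeg : DegLE (fun x => g x - g' x) #K := hdeg.sub hg'deg
    have h1 := (le_omega hδ hδdeg).trans (omega_le_expect _)
    have h2 : ∀ x, cubeSum K (fun x => if g x - g' x = 0 then 0 else 1) x ≤ 2 * (n x - 1) := by
      intro x
      by_cases hx : n x = 1
      · rw [hx, cubeSum, sum_eq_zero]
        · norm_num
        · intro T hT
          rw [if_pos]
          rw [hone (flip T x), sub_self]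
          rw [← hx, hn, cubeSum_flip (mem_powerset.mp hT)]
      · have h3 := hn3 x hx
        have h4 : cubeSum K (fun x => if g x - g' x = 0 then 0 else 1) x ≤ n x +
            cubeSum K (fun x => if g' x = 0 then 0 else 1) x := by
          rw [hn, cubeSum, cubeSum, cubeSum, ← sum_add_distrib]
          refine sum_le_sum fun T _ => ?_
          rw [hg.sq_eq]
          by_cases h5 : g (flip T x) = 0 <;> by_cases h6 : g' (flip T x) = 0 <;> simp [h5, h6]
          split_ifs <;> norm_num
        linarith [hsupp x]
    have h3 := expect_le_expect (s := univ) fun x _ => h2 x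
    rw [expect_cubeSum, ← mul_expect, expect_sub_distrib, expect_const univ_nonempty] at h3
    have h4 : (2 : ℝ) ^ #K * (1 / 2) ^ #K ≤
        2 ^ #K * 𝔼 x, if g x - g' x = 0 then 0 else 1 := by gcongr
    rw [mul_comm, hcancel] at h4
    linarith

end Gap

/-! ### Tight directions, and the linear bound on the weight. -/

section Tight

variable {ι : Type*} [Fintype ι] [DecidableEq ι]

/-- `f` only takes the values `1` and `-1`. -/
def IsSign {α : Type*} (f : α → ℝ) : Prop := ∀ x, f x = 1 ∨ f x = -1

lemma IsSign.sq {α : Type*} {f : α → ℝ} (hf : IsSign f) (x : α) : f x ^ 2 = 1 := by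
  rcases hf x with h | h <;> simp [h]

/-- The total influence of `f`. -/
noncomputable def infl (f : (ι → ℤˣ) → ℝ) : ℝ := ∑ i, 𝔼 x, deriv i f x ^ 2

/-- Half the sum of the weights of the derivatives of `f`. -/
noncomputable def weight (f : (ι → ℤˣ) → ℝ) : ℝ := (∑ i, omega (deriv i f)) / 2

omit [Fintype ι] in
lemma IsSign.deriv {f : (ι → ℤˣ) → ℝ} (hf : IsSign f) (i : ι) : IsTernary (deriv i f) := by
  intro x
  rcases hf (update x i 1) with h1 | h1 <;> rcases hf (update x i (-1)) with h2 | h2 <;>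
    simp only [HypercubeStable.deriv, h1, h2] <;> norm_num

omit [Fintype ι] in
lemma IsSign.restr {f : (ι → ℤˣ) → ℝ} (hf : IsSign f) (H : Finset ι) (a : ι → ℤˣ) :
    IsSign (restr H a f) := fun _ => hf _

lemma IsSign.sum_coeff_sq {f : (ι → ℤˣ) → ℝ} (hf : IsSign f) : ∑ S, coeff f S ^ 2 = 1 := by
  rw [← parseval]; simp [hf.sq]

lemma infl_eq (f : (ι → ℤˣ) → ℝ) : infl f = ∑ S, (#S : ℝ) * coeff f S ^ 2 := by
  have h : ∀ i, 𝔼 x, deriv i f x ^ 2 = ∑ S, if i ∈ S then coeff f S ^ 2 else 0 := by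
    intro i
    rw [parseval]
    simp only [coeff_deriv]
    rw [← sum_filter_add_sum_filter_not univ (fun S => i ∈ S),
      ← sum_filter_add_sum_filter_not univ (fun S => i ∈ S) (fun S => if i ∈ S then _ else _)]
    rw [sum_eq_zero (by intro S hS; simp [(mem_filter.mp hS).2]), zero_add,
      add_eq_left.mpr (sum_eq_zero (by intro S hS; simp [(mem_filter.mp hS).2]))]
    refine sum_nbij' (insert i) (fun S => S.erase i) ?_ ?_ ?_ ?_ ?_
    · intro S _; simp
    · intro S _; simp
    · intro S hS; exact erase_insert (mem_filter.mp hS).2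
    · intro S hS; exact insert_erase (mem_filter.mp hS).2
    · intro S hS; simp [(mem_filter.mp hS).2]
  simp only [infl, h]
  rw [sum_comm]
  refine sum_congr rfl fun S _ => ?_
  rw [← sum_filter]; simp

lemma infl_le {f : (ι → ℤˣ) → ℝ} {d : ℕ} (hf : IsSign f) (hd : DegLE f d) :
    infl f ≤ d * (1 - coeff f ∅ ^ 2) := by
  rw [infl_eq, ← hf.sum_coeff_sq, ← add_sum_erase univ _ (mem_univ ∅),
    ← add_sum_erase univ (fun S => coeff f S ^ 2) (mem_univ ∅)]
  simp only [card_empty, Nat.cast_zero, zero_mul, zero_add, add_sub_cancel_left]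
  rw [mul_sum]
  refine sum_le_sum fun S _ => ?_
  by_cases h : coeff f S = 0
  · simp [h]
  · have : (#S : ℝ) ≤ d := by exact_mod_cast hd S h
    gcongr

omit [Fintype ι] in
/-- A two-valued function on a cube of dimension at least `2` with exactly one bichromatic edge in
each direction takes one of its values only once. -/
lemma exists_isolated {K : Finset ι} {F : Finset ι → ℝ} (hF : IsSign F) (hK : 2 ≤ #K)
    (hex : ∀ v ∈ K, ∃ T ⊆ K, F (T ∆ {v}) ≠ F T)
    (huniq : ∀ v ∈ K, ∀ T ⊆ K, ∀ T' ⊆ K, F (T ∆ {v}) ≠ F T → F (T' ∆ {v}) ≠ F T' →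
      T' = T ∨ T' = T ∆ {v}) :
    ∃ P ⊆ K, ∀ T ⊆ K, T ≠ P → F T = -F P := by
  have hsub : ∀ {T : Finset ι} {v : ι}, T ⊆ K → v ∈ K → T ∆ {v} ⊆ K := fun hT hv =>
    (symmDiff_le_sup).trans (union_subset hT (singleton_subset_iff.mpr hv))
  have hne1 : ∀ (T : Finset ι) (u : ι), T ∆ {u} ≠ T := by
    intro T u h; simp at h
  have hne2 : ∀ (T : Finset ι) (u v : ι), u ≠ v → T ∆ {u} ≠ T ∆ {v} := by
    intro T u v huv h
    exact huv (singleton_injective (symmDiff_right_injective T h))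
  -- The next claim looks at a 2-face: were both `u`-edges monochromatic, the `v`-edge opposite a
  -- bichromatic one would be a second bichromatic edge in direction `v`.
  have hcomm : ∀ (T : Finset ι) (u v : ι), T ∆ {u} ∆ {v} = T ∆ {v} ∆ {u} := fun T u v => by
    rw [symmDiff_assoc, symmDiff_comm ({u} : Finset ι), ← symmDiff_assoc]
  have hsq : ∀ u ∈ K, ∀ v ∈ K, u ≠ v → ∀ T ⊆ K, F (T ∆ {v}) ≠ F T →
      F (T ∆ {u}) ≠ F T ∨ F (T ∆ {v} ∆ {u}) ≠ F (T ∆ {v}) := by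
    intro u hu v hv huv T hT hs
    by_contra! h
    have h1 : F (T ∆ {u} ∆ {v}) ≠ F (T ∆ {u}) := by
      rw [hcomm, h.2, h.1]; exact hs
    rcases huniq v hv T hT (T ∆ {u}) (hsub hT hu) hs h1 with h2 | h2
    · exact hne1 _ _ h2
    · exact hne2 _ _ _ huv h2
  obtain ⟨v, hv, w, hw, hvw⟩ := one_lt_card.mp hK
  obtain ⟨P, hP, hPv, hPw⟩ : ∃ P ⊆ K, F (P ∆ {v}) ≠ F P ∧ F (P ∆ {w}) ≠ F P := by
    obtain ⟨T, hT, hs⟩ := hex v hv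
    rcases hsq w hw v hv hvw.symm T hT hs with h | h
    · exact ⟨T, hT, hs, h⟩
    · refine ⟨T ∆ {v}, hsub hT hv, ?_, h⟩
      rw [symmDiff_assoc, symmDiff_self, symmDiff_bot]
      exact hs.symm
  -- A bichromatic `u`-edge meets both the `v`-edge and the `w`-edge at `P`. If it missed `P`, there
  -- would be two different ones, at `P ∆ {v}` and at `P ∆ {w}`.
  have hall : ∀ u ∈ K, F (P ∆ {u}) ≠ F P := by
    intro u hu
    by_cases huv : u = v
    · exact huv ▸ hPv
    by_cases huw : u = w
    · exact huw ▸ hPw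
    rcases hsq u hu v hv huv P hP hPv with h | h
    · exact h
    rcases hsq u hu w hw huw P hP hPw with h' | h'
    · exact h'
    rcases huniq u hu _ (hsub hP hv) _ (hsub hP hw) h h' with h2 | h2
    · exact absurd h2 (hne2 _ _ _ hvw.symm)
    · rw [symmDiff_assoc] at h2
      have h3 := symmDiff_right_injective P h2
      have : u ∈ ({v} : Finset ι) ∆ {u} := by simp [mem_symmDiff, huv]
      rw [← h3, mem_singleton] at this
      exact absurd this huw
  have hflip : ∀ {S T : Finset ι}, F S ≠ F T → F S = -F T := by
    intro S T h
    rcases hF S with h1 | h1 <;> rcases hF T with h2 | h2 <;> simp_all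
  -- The only bichromatic edge in each direction is the one at `P`, so the value never changes after
  -- the first step away from `P`.
  have hR : ∀ R ⊆ K, R ≠ ∅ → F (P ∆ R) = -F P := by
    intro R
    induction R using Finset.induction_on with
    | empty => intro _ h; exact absurd rfl h
    | insert u R hu ih =>
      intro hR _
      have huK := hR (mem_insert_self u R)
      have hRK : R ⊆ K := (subset_insert u R).trans hR
      by_cases h0 : R = ∅
      · subst h0
        exact hflip (hall u huK)
      · rw [← ih hRK h0]
        have h1 : P ∆ insert u R = P ∆ R ∆ {u} := by
          rw [symmDiff_assoc]
          congr 1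
          ext i
          by_cases hi : i = u
          · subst hi; simp [mem_symmDiff, hu]
          · simp [mem_symmDiff, hi]
        rw [h1]
        by_contra hne
        rcases huniq u huK P hP (P ∆ R) ((symmDiff_le_sup).trans (union_subset hP hRK))
          (hall u huK) hne with h2 | h2
        · rw [symmDiff_eq_left] at h2
          exact h0 h2
        · have := symmDiff_right_injective P h2
          exact hu (this ▸ mem_singleton_self u)
  refine ⟨P, hP, fun T hT hne => ?_⟩
  have := hR (P ∆ T) ((symmDiff_le_sup).trans (union_subset hP hT)) (by
    intro h
    exact hne (symmDiff_eq_bot.mp h).symm)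
  rwa [symmDiff_symmDiff_cancel_left] at this

/-- A Boolean function of degree at most one is, in each direction, either insensitive everywhere or
sensitive everywhere. -/
lemma IsSign.flip_eq_of_degLE_one {φ : (ι → ℤˣ) → ℝ} (hφ : IsSign φ) (hd : DegLE φ 1) (j : ι) :
    ∃ s : ℝ, (s = 1 ∨ s = -1) ∧ ∀ x, φ (flip {j} x) = s * φ x := by
  have hc := (DegLE.deriv (d := 0) hd j).apply_eq
  have hsq : ∀ x, ((φ x - φ (flip {j} x)) / 2) ^ 2 = coeff (HypercubeStable.deriv j φ) ∅ ^ 2 := by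
    intro x; rw [← deriv_sq, hc]
  by_cases h0 : coeff (HypercubeStable.deriv j φ) ∅ = 0
  · refine ⟨1, Or.inl rfl, fun x => ?_⟩
    have := hsq x
    rw [h0] at this
    have := pow_eq_zero_iff (two_ne_zero) |>.mp (this.trans (by norm_num))
    linarith
  · refine ⟨-1, Or.inr rfl, fun x => ?_⟩
    have h1 := hsq x
    rcases hφ x with h2 | h2 <;> rcases hφ (flip {j} x) with h3 | h3 <;> rw [h2, h3] at h1 ⊢
    · exact absurd (pow_eq_zero_iff (two_ne_zero) |>.mp (h1.symm.trans (by norm_num))) h0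
    · norm_num
    · norm_num
    · exact absurd (pow_eq_zero_iff (two_ne_zero) |>.mp (h1.symm.trans (by norm_num))) h0

lemma degLE_zero_of_flip {b : (ι → ℤˣ) → ℝ} (h : ∀ j x, b (flip {j} x) = b x) : DegLE b 0 := by
  intro S hS
  by_contra hne
  obtain ⟨j, hj⟩ := card_pos.mp (Nat.pos_of_ne_zero (fun h0 => hne h0.le))
  have h1 := expect_flip {j} fun x => b x * chi S x
  simp only [h, chi_flip_singleton, hj, if_true, mul_neg] at h1
  rw [expect_neg_distrib] at h1
  exact hS (by unfold coeff; linarith)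

/-- If every variable has the least influence allowed by its degree, the total influence is at
most `2`. -/
lemma infl_le_two_of_tight {f : (ι → ℤˣ) → ℝ} (hf : IsSign f)
    (ht : ∀ i, 𝔼 x, deriv i f x ^ 2 = omega (deriv i f)) : infl f ≤ 2 := by
  classical
  have hf0 : ¬ ∀ x, f x = 0 := by
    intro h
    have := hf.sq 1
    rw [h 1] at this; norm_num at this
  obtain ⟨K, hK, hKd⟩ := exists_coeff_ne_zero hf0
  have hdeg : DegLE f #K := hKd ▸ degLE_deg f
  by_cases hK2 : #K ≤ 2
  · refine (infl_le hf hdeg).trans ?_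
    have h1 : (#K : ℝ) ≤ 2 := by exact_mod_cast hK2
    have h2 := sq_nonneg (coeff f ∅)
    have h3 : coeff f ∅ ^ 2 ≤ 1 := by
      rw [← hf.sum_coeff_sq]
      exact single_le_sum (f := fun S => coeff f S ^ 2) (fun S _ => sq_nonneg _) (mem_univ ∅)
    nlinarith
  push Not at hK2
  -- every direction in `K` has exactly one bichromatic edge in each subcube
  have hone : ∀ v ∈ K, ∀ x, cubeSum (K.erase v) (fun x => deriv v f x ^ 2) x = 1 := by
    intro v hv
    have hcard : #(K.erase v) + 1 = #K := card_erase_add_one hv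
    have hc : coeff (deriv v f) (K.erase v) = coeff f K := by
      rw [coeff_deriv, if_neg (notMem_erase v K), insert_erase hv]
    have hd : DegLE (deriv v f) #(K.erase v) := (hcard ▸ hdeg).deriv v
    have hω : omega (deriv v f) = (1 / 2) ^ #(K.erase v) :=
      le_antisymm (omega_le (hc ▸ hK))
        (le_omega (fun h => hK (hc ▸ (coeff_eq_zero_iff _).mpr h _)) hd)
    have hE := expect_cubeSum (K.erase v) fun x => deriv v f x ^ 2
    rw [ht v, hω, ← mul_pow] at hE
    norm_num at hE
    -- The signed sum is the same nonzero number in every subcube, so each count is at least one,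
    -- while tightness makes the average exactly one.
    have hge : ∀ x, 0 ≤ cubeSum (K.erase v) (fun x => deriv v f x ^ 2) x - 1 := by
      intro x
      obtain ⟨z, w, h1, h2, h3, -⟩ := IsTernary.exists_int_sum (h := fun T => deriv v f (flip T x) *
        chi (K.erase v) (flip T x)) (fun T => (hf.deriv v).mul_chi _ (flip T x)) (K.erase v).powerset
      have h4 := cubeSum_mul_chi_top hd x
      have h5 : cubeSum (K.erase v) (fun x => deriv v f x ^ 2) x = w := by
        rw [← h2, cubeSum]
        refine sum_congr rfl fun T _ => ?_
        rw [mul_pow, sq (chi _ _), chi_mul_self, mul_one]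
      have h6 : (z : ℝ) ≠ 0 := by
        rw [← h1]
        change cubeSum (K.erase v) (fun x => deriv v f x * chi (K.erase v) x) x ≠ 0
        rw [h4, hc]
        exact mul_ne_zero (by positivity) hK
      have h7 : z ≠ 0 := by exact_mod_cast h6
      have h8 : 1 ≤ w := by
        have := abs_pos.mpr h7
        omega
      rw [h5, sub_nonneg]
      exact_mod_cast h8
    have h0 : 𝔼 x, (cubeSum (K.erase v) (fun x => deriv v f x ^ 2) x - 1) = 0 := by
      rw [expect_sub_distrib, hE, expect_const univ_nonempty, sub_self]
    intro x
    have := (expect_eq_zero_iff_of_nonneg fun x _ => hge x).mp h0 x (mem_univ x)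
    linarith
  have hstar : ∀ x, ∃ P ⊆ K, ∀ T ⊆ K, T ≠ P → f (flip T x) = -f (flip P x) := by
    intro x
    have hind : ∀ v T, deriv v f (flip T x) ^ 2 =
        if f (flip (T ∆ {v}) x) = f (flip T x) then 0 else 1 := by
      intro v T
      rw [deriv_sq, flip_symmDiff, symmDiff_comm]
      rcases hf (flip (T ∆ {v}) x) with h1 | h1 <;> rcases hf (flip T x) with h2 | h2 <;>
        rw [h1, h2] <;> norm_num
    refine exists_isolated (F := fun T => f (flip T x)) (fun T => hf _) (by omega) ?_ ?_
    · intro v hv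
      obtain ⟨T, hT, hne⟩ := exists_ne_zero_of_sum_ne_zero (s := (K.erase v).powerset)
        (f := fun T => deriv v f (flip T x) ^ 2) (by
          have := hone v hv x
          rw [cubeSum] at this; rw [this]; exact one_ne_zero)
      refine ⟨T, (mem_powerset.mp hT).trans (erase_subset v K), ?_⟩
      simp only [hind] at hne
      simpa using hne
    · intro v hv T hT T' hT' hs hs'
      -- reduce to representatives avoiding `v`
      have key : ∀ S ⊆ K.erase v, ∀ S' ⊆ K.erase v, f (flip (S ∆ {v}) x) ≠ f (flip S x) →
          f (flip (S' ∆ {v}) x) ≠ f (flip S' x) → S' = S := by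
        intro S hS S' hS' h h'
        by_contra hne
        have h1 := hone v hv x
        rw [cubeSum] at h1
        have h2 := sum_le_sum_of_subset_of_nonneg
          (s := {S', S}) (t := (K.erase v).powerset) (f := fun T => deriv v f (flip T x) ^ 2)
          (by intro U hU; rcases mem_insert.mp hU with rfl | hU
              · exact mem_powerset.mpr hS'
              · rw [mem_singleton.mp hU]; exact mem_powerset.mpr hS)
          (fun U _ _ => sq_nonneg _)
        rw [sum_pair hne, h1, hind, hind, if_neg h, if_neg h'] at h2
        norm_num at h2
      have hred : ∀ T ⊆ K, f (flip (T ∆ {v}) x) ≠ f (flip T x) →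
          T.erase v ⊆ K.erase v ∧
            f (flip (T.erase v ∆ {v}) x) ≠ f (flip (T.erase v) x) := by
        intro T hT h
        refine ⟨erase_subset_erase v hT, ?_⟩
        by_cases hvT : v ∈ T
        · have h1 : T ∆ {v} = T.erase v := by
            ext i; by_cases hi : i = v
            · subst hi; simp [mem_symmDiff, hvT]
            · simp [mem_symmDiff, hi]
          have h2 : T.erase v ∆ {v} = T := by
            rw [← h1, symmDiff_assoc, symmDiff_self, symmDiff_bot]
          rw [h2]
          rw [h1] at h
          exact h.symm
        · rwa [erase_eq_of_notMem hvT]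
      have h1 := hred T hT hs
      have h2 := hred T' hT' hs'
      have h3 := key _ h1.1 _ h2.1 h1.2 h2.2
      have hmem : ∀ i, i ≠ v → (i ∈ T' ↔ i ∈ T) := by
        intro i hi
        have := congrArg (fun S => i ∈ S) h3
        simpa [hi] using this
      by_cases hvv : v ∈ T' ↔ v ∈ T
      · left
        ext i
        by_cases hi : i = v
        · subst hi; exact hvv
        · exact hmem i hi
      · right
        ext i
        by_cases hi : i = v
        · subst hi; simp only [mem_symmDiff, mem_singleton]; tauto
        · simp [mem_symmDiff, hi, hmem i hi]
  have hKne : ∀ u ∈ K, (K.erase u).Nonempty := by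
    intro u hu
    rw [← card_pos]
    have := card_erase_add_one hu
    omega
  have hval : ∀ x, ∀ P ⊆ K, (∀ T ⊆ K, T ≠ P → f (flip T x) = -f (flip P x)) →
      ∀ A ⊆ K, A.Nonempty →
        cubeSum K (fun x => f x * chi A x) x = 2 * (f (flip P x) * chi A (flip P x)) := by
    intro x P hP h A hA hAne
    have h1 := cubeSum_chi K A x
    rw [if_neg (fun hd => by
      obtain ⟨a, ha⟩ := hAne
      exact disjoint_left.mp hd ha (hA ha)), cubeSum] at h1
    rw [cubeSum]
    have h2 : ∀ T ∈ K.powerset, f (flip T x) * chi A (flip T x) =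
        -f (flip P x) * chi A (flip T x) +
          if T = P then 2 * (f (flip P x) * chi A (flip P x)) else 0 := by
      intro T hT
      split_ifs with hTP
      · subst hTP; ring
      · rw [h T (mem_powerset.mp hT) hTP]; ring
    rw [sum_congr rfl h2, sum_add_distrib, ← mul_sum, h1, sum_ite_eq']
    simp [hP]
  have hKK : K.Nonempty := card_pos.mp (by omega)
  set E : ℝ := 2 ^ #K * coeff f K with hE
  have hEx : ∀ x, cubeSum K (fun x => f x * chi K x) x = E := cubeSum_mul_chi_top hdeg
  -- `φ u x` is the `u`-th coordinate of the isolated point of the subcube through `x`: both `E` and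
  -- the signed sum carry a factor `2`, whence `E / 4`.
  set φ : ι → (ι → ℤˣ) → ℝ :=
    fun u x => E / 4 * cubeSum K (fun x => f x * chi (K.erase u) x) x with hφ
  have hφdeg : ∀ u ∈ K, DegLE (φ u) 1 := fun u hu =>
    (hdeg.cubeSum_mul_chi (erase_subset u K) (by rw [card_erase_add_one hu])).const_mul _
  have hφP : ∀ x, ∀ P ⊆ K, (∀ T ⊆ K, T ≠ P → f (flip T x) = -f (flip P x)) →
      E = 2 * (f (flip P x) * chi K (flip P x)) ∧
      ∀ u ∈ K, φ u x = ((flip P x u : ℤ) : ℝ) := by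
    intro x P hP h
    have h1 : E = 2 * (f (flip P x) * chi K (flip P x)) := by
      rw [← hEx x]; exact hval x P hP h K subset_rfl hKK
    refine ⟨h1, fun u hu => ?_⟩
    simp only [hφ]
    rw [hval x P hP h _ (erase_subset u K) (hKne u hu), h1]
    have h2 : chi K (flip P x) = ((flip P x u : ℤ) : ℝ) * chi (K.erase u) (flip P x) := by
      rw [chi, ← mul_prod_erase K _ hu]; rfl
    rw [h2]
    linear_combination ((flip P x u : ℤ) : ℝ) * (chi (K.erase u) (flip P x)) ^ 2 *
      hf.sq (flip P x) + ((flip P x u : ℤ) : ℝ) * chi_mul_self (K.erase u) (flip P x)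
  have hφsign : ∀ u ∈ K, IsSign (φ u) := by
    intro u hu x
    obtain ⟨P, hP, h⟩ := hstar x
    rw [(hφP x P hP h).2 u hu]
    rcases Int.units_eq_one_or (flip P x u) with h | h <;> simp [h]
  -- the majority value on the subcube through `x`
  set b : (ι → ℤˣ) → ℝ := fun x => -(E / 2) * ∏ u ∈ K, φ u x with hb
  have hbP : ∀ x, ∀ P ⊆ K, (∀ T ⊆ K, T ≠ P → f (flip T x) = -f (flip P x)) →
      b x = -f (flip P x) := by
    intro x P hP h
    obtain ⟨h1, h2⟩ := hφP x P hP h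
    have h3 : ∏ u ∈ K, φ u x = chi K (flip P x) := prod_congr rfl h2
    simp only [hb]
    rw [h3, h1]
    linear_combination (-f (flip P x)) * chi_mul_self K (flip P x)
  have hbsign : IsSign b := by
    intro x
    obtain ⟨P, hP, h⟩ := hstar x
    rw [hbP x P hP h]
    rcases hf (flip P x) with h | h <;> simp [h]
  have hbinv : ∀ T ⊆ K, ∀ x, b (flip T x) = b x := by
    intro T hT x
    simp only [hb, hφ, cubeSum_flip hT]
  have hfb : 𝔼 x, (if f x = b x then 0 else 1 : ℝ) = (1 / 2) ^ #K := by
    have h1 : ∀ x, cubeSum K (fun x => if f x = b x then 0 else 1) x = 1 := by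
      intro x
      obtain ⟨P, hP, h⟩ := hstar x
      rw [cubeSum, sum_eq_single P]
      · rw [hbinv P hP, hbP x P hP h, if_neg]
        rcases hf (flip P x) with h | h <;> rw [h] <;> norm_num
      · intro T hT hne
        rw [hbinv T (mem_powerset.mp hT), hbP x P hP h, h T (mem_powerset.mp hT) hne, if_pos rfl]
      · intro h'; exact absurd (mem_powerset.mpr hP) h'
    have h2 := expect_cubeSum K fun x => if f x = b x then 0 else (1 : ℝ)
    simp only [h1] at h2
    rw [expect_const univ_nonempty] at h2
    rw [one_div, inv_pow, eq_comm, inv_eq_iff_eq_inv, ← one_div, eq_div_iff]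
    · exact h2.symm
    · intro h3; rw [h3, mul_zero] at h2; norm_num at h2
  have hsmall : (1 / 2 : ℝ) ^ #K ≤ 1 / 8 := by
    calc (1 / 2 : ℝ) ^ #K ≤ (1 / 2) ^ 3 :=
          pow_le_pow_of_le_one (by norm_num) (by norm_num) hK2
      _ = 1 / 8 := by norm_num
  have hbflip : ∀ j x, b (flip {j} x) = b x := by
    intro j
    have hex : ∀ u, ∃ s : ℝ, u ∈ K → (s = 1 ∨ s = -1) ∧ ∀ x, φ u (flip {j} x) = s * φ u x := by
      intro u
      by_cases hu : u ∈ K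
      · obtain ⟨s, hs⟩ := (hφsign u hu).flip_eq_of_degLE_one (hφdeg u hu) j
        exact ⟨s, fun _ => hs⟩
      · exact ⟨1, fun h => absurd h hu⟩
    choose s hs using hex
    have hprod : ∀ x, b (flip {j} x) = (∏ u ∈ K, s u) * b x := by
      intro x
      simp only [hb]
      rw [prod_congr rfl fun u hu => (hs u hu).2 x, prod_mul_distrib]
      ring
    have hpm : (∏ u ∈ K, s u) = 1 ∨ (∏ u ∈ K, s u) = -1 := by
      have h1 := hbsign 1
      have h2 := hbsign (flip {j} 1)
      rw [hprod] at h2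
      rcases h1 with h1 | h1 <;> rw [h1] at h2 <;> rcases h2 with h2 | h2
      · left; linarith
      · right; linarith
      · right; linarith
      · left; linarith
    rcases hpm with h1 | h1
    · intro x; rw [hprod, h1, one_mul]
    -- If `b` changed sign in direction `j`, then `f` would be sensitive there unless one endpoint
    -- is isolated, so the influence would be at least `1 - 2/8`. Tightness only allows powers of
    -- `1/2`, so it would be `1`; then `{j}` carries all the Fourier weight, although `coeff f K ≠
    -- 0` and `#K ≥ 3`.
    exfalso
    have h2 : ∀ x, 1 - (if f x = b x then 0 else 1) -
        (if f (flip {j} x) = b (flip {j} x) then 0 else 1) ≤ deriv j f x ^ 2 := by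
      intro x
      rw [deriv_sq, hprod, h1]
      split_ifs with h3 h4
      · rw [h3, h4, show ((b x - -1 * b x) / 2) ^ 2 = b x ^ 2 by ring, hbsign.sq]; norm_num
      · linarith [sq_nonneg ((f x - f (flip {j} x)) / 2)]
      · linarith [sq_nonneg ((f x - f (flip {j} x)) / 2)]
      · linarith [sq_nonneg ((f x - f (flip {j} x)) / 2)]
    have h3 := expect_le_expect (s := univ) fun x _ => h2 x
    rw [expect_sub_distrib, expect_sub_distrib, expect_const univ_nonempty,
      expect_flip {j} fun x => if f x = b x then 0 else (1 : ℝ), hfb, ht j] at h3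
    have h4 : ¬ ∀ x, deriv j f x = 0 := by
      intro h; rw [omega_of_zero h] at h3; linarith
    have h5 : deg (deriv j f) = 0 := by
      by_contra h5
      rw [omega_of_ne h4] at h3
      have : (1 / 2 : ℝ) ^ deg (deriv j f) ≤ (1 / 2) ^ 1 :=
        pow_le_pow_of_le_one (by norm_num) (by norm_num) (Nat.one_le_iff_ne_zero.mpr h5)
      linarith
    have h6 : DegLE (deriv j f) 0 := h5 ▸ degLE_deg (deriv j f)
    have h7 := ht j
    rw [omega_of_ne h4, h5, pow_zero] at h7
    simp only [h6.apply_eq] at h7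
    rw [expect_const univ_nonempty, coeff_deriv, if_neg (notMem_empty j)] at h7
    have h8 := sum_le_sum_of_subset_of_nonneg (s := {insert j ∅, K}) (t := univ)
      (f := fun S => coeff f S ^ 2) (subset_univ _) (fun S _ _ => sq_nonneg _)
    rw [hf.sum_coeff_sq, sum_pair (by rintro rfl; simp at hK2), h7] at h8
    have : 0 < coeff f K ^ 2 := by positivity
    linarith
  have hbconst := (degLE_zero_of_flip hbflip).apply_eq
  set β := coeff b ∅ with hβ
  have hβ2 : β ^ 2 = 1 := by rw [← hbconst 1]; exact hbsign.sq 1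
  have hmean : coeff f ∅ = β * (1 - 2 * (1 / 2) ^ #K) := by
    have h1 : ∀ x, f x * chi ∅ x = β * (1 - 2 * (if f x = b x then 0 else 1)) := by
      intro x
      rw [chi_empty, mul_one, ← hbconst x]
      split_ifs with h
      · rw [h]; ring
      · rcases hf x with h2 | h2 <;> rcases hbsign x with h3 | h3 <;> rw [h2, h3] at h ⊢ <;>
          first | exact absurd rfl h | norm_num
    rw [coeff, expect_congr rfl fun x _ => h1 x, ← mul_expect, expect_sub_distrib,
      expect_const univ_nonempty, ← mul_expect, hfb]
  -- `f` leaves the constant `β` with density `2^(-#K)`, so `1 - mean^2 ≤ 4 * 2^(-#K)` and the total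
  -- influence is at most `4 * #K * 2^(-#K) ≤ 2`.
  refine (infl_le hf hdeg).trans ?_
  rw [hmean, mul_pow, hβ2, one_mul]
  have h1 : (#K : ℝ) * (1 / 2) ^ #K ≤ 1 / 2 := by
    have h2 : ∀ m : ℕ, 3 ≤ m → (m : ℝ) * (1 / 2) ^ m ≤ 1 / 2 := by
      intro m hm
      induction m, hm using Nat.le_induction with
      | base => norm_num
      | succ m hm ih =>
        have h3 : (3 : ℝ) ≤ m := by exact_mod_cast hm
        have h4 : (0 : ℝ) < (1 / 2) ^ m := by positivity
        rw [pow_succ]; push_cast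
        nlinarith
    exact h2 _ hK2
  have h2 : (0 : ℝ) < (1 / 2) ^ #K := by positivity
  nlinarith [Nat.cast_nonneg (α := ℝ) #K]

omit [Fintype ι] in
lemma restr_sq (H : Finset ι) (a : ι → ℤˣ) (g : (ι → ℤˣ) → ℝ) (x : ι → ℤˣ) :
    restr H a g x ^ 2 = restr H a (fun y => g y ^ 2) x := rfl

/-- Fix the coordinates of the set `H` of non-tight directions. For the others the mean influence is
preserved while the mean `omega` cannot drop, so each restriction is tight in every direction and
the tight influences sum to at most `2`. A non-tight direction has `omega` at most `2/3` of its
influence; hence `2 * weight f ≤ 2/3 * d + 1/3 * 2`. -/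
lemma weight_le {f : (ι → ℤˣ) → ℝ} {d : ℕ} (hf : IsSign f) (hd : DegLE f d) :
    weight f ≤ (d + 1) / 3 := by
  classical
  set H : Finset ι := univ.filter fun i => 𝔼 x, deriv i f x ^ 2 ≠ omega (deriv i f) with hH
  have hexp : ∀ i, i ∉ H → 𝔼 a, 𝔼 x, deriv i (restr H a f) x ^ 2 = 𝔼 x, deriv i f x ^ 2 := by
    intro i hi
    simp only [deriv_restr_of_notMem hi, restr_sq]
    exact expect_restr H _
  have htight : ∀ a i, 𝔼 x, deriv i (restr H a f) x ^ 2 = omega (deriv i (restr H a f)) := by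
    intro a i
    by_cases hi : i ∈ H
    · rw [deriv_restr_of_mem hi, omega_of_zero fun _ => rfl]; simp
    have h1 : ∀ a, 0 ≤ 𝔼 x, deriv i (restr H a f) x ^ 2 - omega (deriv i (restr H a f)) := fun a =>
      sub_nonneg.mpr (omega_le_expect_sq ((hf.restr H a).deriv i))
    have h2 : 𝔼 x, deriv i f x ^ 2 = omega (deriv i f) := by simpa [hH] using hi
    have h3 : 𝔼 a, (𝔼 x, deriv i (restr H a f) x ^ 2 - omega (deriv i (restr H a f))) = 0 := by
      refine le_antisymm ?_ (expect_nonneg fun a _ => h1 a)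
      rw [expect_sub_distrib, hexp i hi, h2, sub_nonpos]
      simp only [deriv_restr_of_notMem hi]
      exact omega_le_expect_restr H _
    have := (expect_eq_zero_iff_of_nonneg fun a _ => h1 a).mp h3 a (mem_univ a)
    linarith
  have htwo : ∑ i ∈ Hᶜ, 𝔼 x, deriv i f x ^ 2 ≤ 2 := by
    calc ∑ i ∈ Hᶜ, 𝔼 x, deriv i f x ^ 2
        = ∑ i ∈ Hᶜ, 𝔼 a, 𝔼 x, deriv i (restr H a f) x ^ 2 :=
          sum_congr rfl fun i hi => (hexp i (mem_compl.mp hi)).symm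
      _ = 𝔼 a, ∑ i ∈ Hᶜ, 𝔼 x, deriv i (restr H a f) x ^ 2 := (expect_sum_comm _ _ _).symm
      _ ≤ 𝔼 a, infl (restr H a f) := expect_le_expect fun a _ =>
          sum_le_sum_of_subset_of_nonneg (subset_univ _) fun i _ _ =>
            expect_nonneg fun x _ => sq_nonneg _
      _ ≤ 2 := expect_le univ_nonempty fun a _ => infl_le_two_of_tight (hf.restr H a) (htight a)
  have hinfl : infl f ≤ d := by
    refine (infl_le hf hd).trans ?_
    nlinarith [sq_nonneg (coeff f ∅), Nat.cast_nonneg (α := ℝ) d]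
  have hsplit : ∀ i, omega (deriv i f) ≤ 2 / 3 * 𝔼 x, deriv i f x ^ 2 +
      if i ∈ Hᶜ then (1 / 3) * 𝔼 x, deriv i f x ^ 2 else 0 := by
    intro i
    split_ifs with hi
    · have h2 : 𝔼 x, deriv i f x ^ 2 = omega (deriv i f) := by simpa [hH] using hi
      rw [h2]; linarith
    · rw [mem_compl, not_not, hH, mem_filter] at hi
      rcases omega_gap (hf.deriv i) with h | h
      · exact absurd h hi.2
      · linarith
  have hsum := sum_le_sum (s := univ) fun i _ => hsplit i
  rw [sum_add_distrib, ← mul_sum, sum_ite_mem, univ_inter, ← mul_sum] at hsum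
  change _ ≤ 2 / 3 * infl f + _ at hsum
  unfold weight
  linarith

end Tight

/-! ### Block sensitivity, and a bound on the weight independent of the degree. -/

section Blocks

variable {ι : Type*} [Fintype ι] [DecidableEq ι]

/-- At some point, `f` is sensitive to `m` pairwise disjoint blocks of coordinates. -/
def HasBlocks (f : (ι → ℤˣ) → ℝ) (m : ℕ) : Prop :=
  ∃ (x : ι → ℤˣ) (B : Fin m → Finset ι), Pairwise (Disjoint on B) ∧ ∀ l, f (flip (B l) x) ≠ f x

omit [Fintype ι] in
lemma hasBlocks_of {κ : Type*} [Fintype κ] {f : (ι → ℤˣ) → ℝ} (x : ι → ℤˣ) (B : κ → Finset ι)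
    (hB : Pairwise (Disjoint on B)) (h : ∀ l, f (flip (B l) x) ≠ f x) :
    HasBlocks f (Fintype.card κ) :=
  ⟨x, B ∘ (Fintype.equivFin κ).symm,
    fun _ _ hne => hB ((Fintype.equivFin κ).symm.injective.ne hne), fun _ => h _⟩

omit [Fintype ι] [DecidableEq ι] in
lemma chi_one (S : Finset ι) : chi S 1 = 1 := by simp [chi]

open Polynomial in
/-- A Boolean function of degree at most `d` which is sensitive to every coordinate at `1` has at
most `d ^ 2` coordinates. -/
lemma card_le_sq_of_sensitive {g : (ι → ℤˣ) → ℝ} {d : ℕ} (hg : IsSign g) (hd : DegLE g d)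
    (hs : ∀ l, g (flip {l} 1) ≠ g 1) : Fintype.card ι ≤ d ^ 2 := by
  -- `P t` is the mean of `g` under the product measure with all biases `t`, so it is bounded by `1`
  -- on `[-1, 1]`. Full sensitivity at `1` makes `P'(1)` equal to `± card ι`, and Markov's
  -- inequality applies.
  set P : ℝ[X] := ∑ S : Finset ι, C (coeff g S) * X ^ #S with hP
  have heval : ∀ t, P.eval t = 𝔼 y, g y * ∏ l, (1 + t * ((y l : ℤ) : ℝ)) := by
    intro t
    have h1 : ∀ y : ι → ℤˣ, g y * ∏ l, (1 + t * ((y l : ℤ) : ℝ)) =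
        ∑ S, t ^ #S * (g y * chi S y) := by
      intro y
      rw [prod_one_add, powerset_univ, mul_sum]
      refine sum_congr rfl fun S _ => ?_
      rw [prod_mul_distrib, prod_const, chi]; ring
    simp only [h1, expect_sum_comm, ← mul_expect]
    rw [hP, eval_finsetSum]
    refine sum_congr rfl fun S _ => ?_
    simp only [eval_mul, eval_C, eval_pow, eval_X]
    rw [mul_comm]; rfl
  have hbound : ∀ t ∈ Set.Icc (-1 : ℝ) 1, |P.eval t| ≤ 1 := by
    intro t ht
    rw [heval]
    have hnn : ∀ y : ι → ℤˣ, 0 ≤ ∏ l, (1 + t * ((y l : ℤ) : ℝ)) := by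
      intro y
      refine prod_nonneg fun l _ => ?_
      rcases Int.units_eq_one_or (y l) with h | h <;> rw [h] <;> push_cast <;> linarith [ht.1, ht.2]
    refine (abs_expect_le _ _).trans ?_
    have h1 : ∀ y : ι → ℤˣ, |g y * ∏ l, (1 + t * ((y l : ℤ) : ℝ))| =
        ∑ S, t ^ #S * chi S y := by
      intro y
      rw [abs_mul, abs_of_nonneg (hnn y), show |g y| = 1 by rcases hg y with h | h <;> simp [h],
        one_mul, prod_one_add, powerset_univ]
      refine sum_congr rfl fun S _ => ?_
      rw [prod_mul_distrib, prod_const, chi]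
    simp only [h1, expect_sum_comm, ← mul_expect, expect_chi]
    simp
  have hderiv : (derivative P).eval 1 = Fintype.card ι * g 1 := by
    have h1 : ∀ l, ∑ S, (if l ∈ S then coeff g S else 0) = g 1 := by
      intro l
      have h2 : g 1 - g (flip {l} 1) = ∑ S, 2 * (if l ∈ S then coeff g S else 0) := by
        rw [fourier g 1, fourier g (flip {l} 1), ← sum_sub_distrib]
        refine sum_congr rfl fun S _ => ?_
        rw [chi_flip_singleton, chi_one]
        split_ifs <;> ring
      rw [← mul_sum] at h2
      have h3 := hs l
      rcases hg 1 with h4 | h4 <;> rcases hg (flip {l} 1) with h5 | h5 <;>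
        rw [h4, h5] at h2 <;> rw [h4, h5] at h3 <;> rw [h4] <;>
        first | exact absurd rfl h3 | linarith
    have h2 : ∑ l, ∑ S, (if l ∈ S then coeff g S else 0) = Fintype.card ι * g 1 := by
      simp only [h1]; simp
    rw [← h2, sum_comm, hP, derivative_sum, eval_finsetSum]
    refine sum_congr rfl fun S _ => ?_
    rw [sum_ite_mem, univ_inter, sum_const, nsmul_eq_mul, derivative_C_mul_X_pow, eval_C_mul,
      eval_pow, eval_X, one_pow]
    ring
  have hPdeg : P.degree ≤ d := by
    refine (degree_sum_le _ _).trans (Finset.sup_le fun S _ => ?_)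
    by_cases h : coeff g S = 0
    · simp [h]
    · exact (degree_C_mul_X_pow_le _ _).trans (by exact_mod_cast hd S h)
  have hmarkov : ∀ Q : ℝ[X], Q.degree ≤ d → (∀ t ∈ Set.Icc (-1 : ℝ) 1, |Q.eval t| ≤ 1) →
      (derivative Q).eval 1 ≤ (d : ℝ) ^ 2 := by
    intro Q h1 h2
    have h3 := Chebyshev.eval_iterate_derivative_le_of_forall_abs_le_one (k := 1) le_rfl h1 h2
    simp only [iterate_one] at h3
    rw [Chebyshev.derivative_T_eval_one] at h3
    exact_mod_cast h3
  have : (Fintype.card ι : ℝ) ≤ (d : ℝ) ^ 2 := by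
    rcases hg 1 with h | h
    · have := hmarkov P hPdeg hbound
      rw [hderiv, h] at this; linarith
    · have := hmarkov (-P) (by rwa [degree_neg]) (by simpa using hbound)
      rw [derivative_neg, eval_neg, hderiv, h] at this; linarith
  exact_mod_cast this

lemma DegLE.sum {κ : Type*} {s : Finset κ} {f : κ → (ι → ℤˣ) → ℝ} {d : ℕ}
    (h : ∀ k ∈ s, DegLE (f k) d) : DegLE (fun x => ∑ k ∈ s, f k x) d := by
  intro S hS
  rw [coeff_sum] at hS
  obtain ⟨k, hk, hne⟩ := exists_ne_zero_of_sum_ne_zero hS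
  exact h k hk S hne

/-- Letting one variable flip a whole block, and freezing the rest, gives a function of `m`
variables, of no larger degree, sensitive to all of them at one point. -/
lemma HasBlocks.le_sq {f : (ι → ℤˣ) → ℝ} {d m : ℕ} (hf : IsSign f) (hd : DegLE f d)
    (h : HasBlocks f m) : m ≤ d ^ 2 := by
  classical
  obtain ⟨x, B, hB, hs⟩ := h
  have huniq : ∀ {i l l'}, i ∈ B l → i ∈ B l' → l = l' := by
    intro i l l' h1 h2
    by_contra hne
    exact disjoint_left.mp (hB hne) h1 h2
  set z : (Fin m → ℤˣ) → ι → ℤˣ := fun y i =>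
    if h : ∃ l, i ∈ B l then x i * y h.choose else x i with hz
  have hz1 : z 1 = x := by
    funext i; simp only [hz]; split_ifs <;> simp
  have hzl : ∀ l, z (flip {l} 1) = flip (B l) x := by
    intro l; funext i
    simp only [hz, flip_apply]
    split_ifs with h1 h2 h3 h4 h5
    · simp
    · exact absurd (mem_singleton.mp h2 ▸ h1.choose_spec) h3
    · exact absurd (mem_singleton.mpr (huniq h1.choose_spec h4)) h2
    · simp
    · exact absurd ⟨l, h5⟩ h1
    · rfl
  have hgd : DegLE (fun y => f (z y)) d := by
    have h1 : (fun y => f (z y)) = fun y => ∑ S, coeff f S * chi S (z y) := by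
      funext y; exact fourier f (z y)
    rw [h1]
    refine DegLE.sum fun S _ => ?_
    by_cases hS : coeff f S = 0
    · simpa [hS] using (degLE_const (ι := Fin m) 0).mono (Nat.zero_le d)
    refine DegLE.const_mul ?_ _
    refine (DegLE.prod S fun i _ => ?_).mono (hd S hS)
    by_cases hi : ∃ l, i ∈ B l
    · have h2 := (degLE_chi ({hi.choose} : Finset (Fin m))).const_mul ((x i : ℤ) : ℝ)
      rw [card_singleton] at h2
      refine (show (fun y => ((z y i : ℤ) : ℝ)) = _ from ?_) ▸ h2
      funext y; simp [hz, hi, chi]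
    · refine (show (fun y => ((z y i : ℤ) : ℝ)) = _ from ?_) ▸
        (degLE_const ((x i : ℤ) : ℝ)).mono zero_le_one
      funext y; simp [hz, hi]
  have := card_le_sq_of_sensitive (g := fun y => f (z y)) (fun y => hf _) hgd (by
    intro l
    simp only [hz1, hzl]
    exact hs l)
  simpa using this

/-- Restricting the variables in a maximal family of `l` disjoint monomials of top degree lowers the
degree, costs at most `(d + 1) * l / 2 ^ (d + 1)` of weight and removes `l` sensitive blocks. -/
lemma exists_restr {f : (ι → ℤˣ) → ℝ} {d : ℕ} (hd : DegLE f (d + 1)) :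
    ∃ (H : Finset ι) (l : ℕ),
      weight f ≤ (d + 1) / 2 ^ (d + 1) * l + 𝔼 a, weight (restr H a f) ∧
      (∀ a, DegLE (restr H a f) d) ∧
      ∀ a m, HasBlocks (restr H a f) m → HasBlocks f (m + l) := by
  classical
  set Q : Finset (Finset (Finset ι)) := univ.filter fun F =>
    (∀ S ∈ F, coeff f S ≠ 0 ∧ #S = d + 1) ∧ (F : Set (Finset ι)).PairwiseDisjoint id with hQ
  obtain ⟨F, hFQ, hmax⟩ := exists_max_image Q card ⟨∅, by simp [hQ]⟩
  obtain ⟨hF, hdisj⟩ : (∀ S ∈ F, coeff f S ≠ 0 ∧ #S = d + 1) ∧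
    (F : Set (Finset ι)).PairwiseDisjoint id := by simpa [hQ] using hFQ
  set H := F.biUnion id with hH
  -- By maximality `H` meets every monomial of top degree, so fixing it lowers the degree.
  have hhit : ∀ S, coeff f S ≠ 0 → #S = d + 1 → ¬ Disjoint S H := by
    intro S hS hcard hSH
    have hSF : S ∉ F := by
      intro h
      have h1 : S ⊆ H := subset_biUnion_of_mem id h
      have h2 := disjoint_self.mp (hSH.mono_right h1)
      rw [h2] at hcard; simp at hcard
    have h1 := hmax (insert S F) (by
      simp only [hQ, mem_filter, mem_univ, true_and, mem_insert, forall_eq_or_imp]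
      refine ⟨⟨⟨hS, hcard⟩, hF⟩, ?_⟩
      rw [coe_insert]
      refine hdisj.insert fun T hT _ => ?_
      exact hSH.mono_right (subset_biUnion_of_mem id hT))
    rw [card_insert_of_notMem hSF] at h1
    omega
  refine ⟨H, #F, ?_, ?_, ?_⟩
  · have h1 : ∀ i ∈ H, omega (deriv i f) ≤ (1 / 2) ^ d := by
      intro i hi
      obtain ⟨M, hM, hiM⟩ := mem_biUnion.mp hi
      change i ∈ M at hiM
      have h2 : coeff (deriv i f) (M.erase i) ≠ 0 := by
        rw [coeff_deriv, if_neg (notMem_erase i M), insert_erase hiM]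
        exact (hF M hM).1
      have h3 := omega_le h2
      have h4 := card_erase_add_one hiM
      rw [(hF M hM).2] at h4
      rwa [show #(M.erase i) = d by omega] at h3
    have h2 : (#H : ℝ) ≤ (d + 1) * #F := by
      have := card_biUnion_le_card_mul F id (d + 1) fun S hS => (hF S hS).2.le
      rw [mul_comm]; exact_mod_cast this
    have h3 : ∑ i ∈ H, omega (deriv i f) ≤ (d + 1) * #F * (1 / 2) ^ d := by
      calc ∑ i ∈ H, omega (deriv i f) ≤ ∑ i ∈ H, (1 / 2 : ℝ) ^ d := sum_le_sum h1
        _ = #H * (1 / 2) ^ d := by simp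
        _ ≤ _ := by gcongr
    have h4 : ∑ i ∈ Hᶜ, omega (deriv i f) ≤ 2 * 𝔼 a, weight (restr H a f) := by
      calc ∑ i ∈ Hᶜ, omega (deriv i f)
          ≤ ∑ i ∈ Hᶜ, 𝔼 a, omega (restr H a (deriv i f)) :=
            sum_le_sum fun i _ => omega_le_expect_restr H _
        _ = 𝔼 a, ∑ i ∈ Hᶜ, omega (deriv i (restr H a f)) := by
            rw [expect_sum_comm]
            refine sum_congr rfl fun i hi => expect_congr rfl fun a _ => ?_
            rw [deriv_restr_of_notMem (mem_compl.mp hi)]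
        _ ≤ 𝔼 a, 2 * weight (restr H a f) := by
            refine expect_le_expect fun a _ => ?_
            rw [weight, mul_div_cancel₀ _ two_ne_zero]
            exact sum_le_sum_of_subset_of_nonneg (subset_univ _) fun i _ _ => omega_nonneg _
        _ = _ := (mul_expect _ _ _).symm
    have h5 : weight f = (∑ i ∈ H, omega (deriv i f) + ∑ i ∈ Hᶜ, omega (deriv i f)) / 2 := by
      rw [sum_add_sum_compl, weight]
    have h6 : ((d : ℝ) + 1) / 2 ^ (d + 1) * #F = (d + 1) * #F * (1 / 2) ^ d / 2 := by
      rw [one_div, inv_pow, pow_succ]; field_simp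
    rw [h5, h6]
    linarith
  · intro a
    rw [restr_eq_sum]
    refine degLE_sum_chi fun S _ h => ?_
    have h1 := left_ne_zero_of_mul h
    have h2 := hd S h1
    rcases h2.eq_or_lt with h3 | h3
    · have h4 := hhit S h1 h3
      rw [not_disjoint_iff] at h4
      obtain ⟨i, hiS, hiH⟩ := h4
      have : S \ H ⊂ S := (ssubset_iff_of_subset sdiff_subset).mpr ⟨i, hiS, by simp [hiH]⟩
      have := card_lt_card this
      omega
    · exact (card_le_card sdiff_subset).trans (by omega)
  · rintro a m ⟨x, B, hB, hs⟩
    set x' := H.piecewise a x with hx'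
    -- Were `f` constant on the `M`-subcube, its signed sum against `chi M` would vanish; but it is
    -- `2^#M * coeff f M`, as `M` has top degree.
    have hM : ∀ M : F, ∃ T ⊆ M.1, f (flip T x') ≠ f x' := by
      intro M
      by_contra! hcon
      obtain ⟨hc, hcard⟩ := hF M.1 M.2
      have h1 := cubeSum_mul_chi_top (K := M.1) (hcard ▸ hd) x'
      have h2 : cubeSum M.1 (fun x => f x * chi M.1 x) x' = f x' * cubeSum M.1 (chi M.1) x' := by
        rw [cubeSum, cubeSum, mul_sum]
        exact sum_congr rfl fun T hT => by rw [hcon T (mem_powerset.mp hT)]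
      rw [h2, cubeSum_chi, if_neg, mul_zero] at h1
      · exact mul_ne_zero (by positivity) hc h1.symm
      · rw [disjoint_self]
        intro h; rw [bot_eq_empty] at h; rw [h] at hcard; simp at hcard
    choose T hT hTs using hM
    have hTH : ∀ M : F, T M ⊆ H := fun M => (hT M).trans (subset_biUnion_of_mem id M.2)
    have := hasBlocks_of (f := f) (κ := Fin m ⊕ F) x' (Sum.elim (fun l => B l \ H) T) (by
      rintro (l | M) (l' | M') hne
      · exact (hB (by simpa using hne)).mono sdiff_subset sdiff_subset
      · exact (disjoint_sdiff.mono_left (hTH M')).symm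
      · exact disjoint_sdiff.mono_left (hTH M)
      · have h1 : M.1 ≠ M'.1 := fun h => hne (by rw [Subtype.ext h])
        exact (hdisj M.2 M'.2 h1).mono (hT M) (hT M')) (by
      rintro (l | M)
      · have h1 : flip (B l \ H) x' = H.piecewise a (flip (B l) x) := by
          funext i
          by_cases hi : i ∈ H <;> simp [flip, hx', hi]
        simp only [Sum.elim_inl, h1]
        exact hs l
      · exact hTs M)
    simpa using this

/-- A potential in the degree and the remaining block budget `b`. The cubic `p` satisfies `2 p(d) -
p(d+1) = d (d+1)^2`, exactly what the step from `d` to `d+1` needs when the budget is capped at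
`(d+1)^2`. Since `p(10) = 1660`, the bound at `d = 10` reads `209/60 + 11 b / 2048`. -/
lemma weight_le_blocks {d : ℕ} (h10 : 10 ≤ d) {f : (ι → ℤˣ) → ℝ} (hf : IsSign f)
    (hd : DegLE f d) {b : ℕ} (hb : ∀ m, HasBlocks f m → m ≤ b) :
    weight f ≤ (209 / 60 + 1660 / 2048) -
      ((d : ℝ) ^ 3 + 5 * d ^ 2 + 14 * d + 20) / 2 ^ (d + 1) + (d + 1) / 2 ^ (d + 1) * b := by
  induction d, h10 using Nat.le_induction generalizing f b with
  | base =>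
    obtain ⟨H, l, h1, h2, h3⟩ := exists_restr (d := 9) hd
    have h4 : 𝔼 a, weight (restr H a f) ≤ 10 / 3 := by
      refine expect_le univ_nonempty fun a _ => (weight_le (hf.restr H a) (h2 a)).trans ?_
      norm_num
    have h5 : l ≤ b := by
      have := hb _ (h3 1 0 ⟨1, Fin.elim0, fun i => i.elim0, fun i => i.elim0⟩)
      omega
    have h5 : (l : ℝ) ≤ b := by exact_mod_cast h5
    -- The base case is `11/20` of the bound `10/3 + 20 b / 2048` plus `9/20` of the bound `11/3`.
    have h6 := weight_le hf hd
    norm_num at h1 h6 ⊢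
    linarith
  | succ d h10 ih =>
    obtain ⟨H, l, h1, h2, h3⟩ := exists_restr hd
    set b' := min b ((d + 1) ^ 2) with hb'
    have hbb : ∀ m, HasBlocks f m → m ≤ b' := fun m hm => le_min (hb m hm) (hm.le_sq hf hd)
    have hlb : l ≤ b' := by
      have := hbb _ (h3 1 0 ⟨1, Fin.elim0, fun i => i.elim0, fun i => i.elim0⟩)
      omega
    -- The `l` blocks used by the restriction are charged to the budget.
    have h4 := expect_le univ_nonempty fun a (_ : a ∈ univ) =>
      ih (hf.restr H a) (h2 a) (b := b' - l) fun m hm => by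
        have := hbb _ (h3 a m hm)
        omega
    rw [Nat.cast_sub hlb] at h4
    have h5 : (b' : ℝ) ≤ b := by exact_mod_cast min_le_left _ _
    have h6 : (b' : ℝ) ≤ (d + 1) ^ 2 := by exact_mod_cast min_le_right b ((d + 1) ^ 2)
    have hp : (0 : ℝ) < 2 ^ (d + 1) := by positivity
    have h7 := h1.trans (add_le_add_right h4 _)
    refine h7.trans ?_
    rw [← sub_nonneg]
    have hd0 : (0 : ℝ) ≤ d := Nat.cast_nonneg d
    have key : 0 ≤ ((d : ℝ) + 2) * (b - b') + d * ((d + 1) ^ 2 - b') := by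
      have h8 : 0 ≤ (b : ℝ) - b' := by linarith
      have h9 : 0 ≤ ((d : ℝ) + 1) ^ 2 - b' := by linarith
      positivity
    have h11 : (0 : ℝ) ≤ (((d : ℝ) + 2) * (b - b') + d * ((d + 1) ^ 2 - b')) /
        (2 * 2 ^ (d + 1)) := by positivity
    refine h11.trans (le_of_eq ?_)
    rw [pow_succ 2 (d + 1)]
    push_cast
    field_simp
    ring

/-- The weight of a Boolean function is bounded. -/
lemma weight_le_const {f : (ι → ℤˣ) → ℝ} {d : ℕ} (hf : IsSign f) (hd : DegLE f d) :
    weight f ≤ 4.394 := by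
  have h10 : 10 ≤ max d 10 := le_max_right _ _
  have hd' : DegLE f (max d 10) := hd.mono (le_max_left _ _)
  generalize max d 10 = e at h10 hd'
  have h := weight_le_blocks h10 hf hd' fun m hm => hm.le_sq hf hd'
  have hp : (0 : ℝ) < 2 ^ (e + 1) := by positivity
  have he : (0 : ℝ) ≤ e := Nat.cast_nonneg e
  -- With the full budget `e^2` the block term is absorbed by the cubic, leaving only the constant.
  have h1 : ((e : ℝ) + 1) / 2 ^ (e + 1) * ((e ^ 2 : ℕ) : ℝ) ≤
      ((e : ℝ) ^ 3 + 5 * e ^ 2 + 14 * e + 20) / 2 ^ (e + 1) := by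
    rw [div_mul_eq_mul_div]
    gcongr
    push_cast
    nlinarith
  norm_num at h ⊢
  norm_num at h1
  linarith

open Classical in
/-- A Boolean function of degree at most `k` has at most `4.394 * 2 ^ k` relevant variables. -/
lemma card_relevant_le {f : (ι → ℤˣ) → ℝ} {k : ℕ} (hf : IsSign f) (hd : DegLE f k) :
    (#(univ.filter fun i => ∃ x, f (flip {i} x) ≠ f x) : ℝ) ≤ 4.394 * 2 ^ k := by
  set R := univ.filter fun i => ∃ x, f (flip {i} x) ≠ f x
  have h1 : ∀ i ∈ R, 2 * (1 / 2 : ℝ) ^ k ≤ omega (deriv i f) := by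
    intro i hi
    obtain ⟨x, hx⟩ := (mem_filter.mp hi).2
    have hne : ¬ ∀ x, deriv i f x = 0 := by
      intro h
      have h2 := deriv_sq i f x
      rw [h x] at h2
      have := pow_eq_zero_iff (two_ne_zero) |>.mp (h2.symm.trans (by norm_num))
      apply hx; linarith
    obtain ⟨S, hS, hcard⟩ := exists_coeff_ne_zero hne
    rw [coeff_deriv] at hS
    split_ifs at hS with hi
    · exact absurd rfl hS
    have h2 := hd _ hS
    rw [card_insert_of_notMem hi] at h2
    rw [omega_of_ne hne, ← hcard]
    calc 2 * (1 / 2 : ℝ) ^ k ≤ 2 * (1 / 2) ^ (#S + 1) := by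
          gcongr 2 * ?_
          exact pow_le_pow_of_le_one (by norm_num) (by norm_num) h2
      _ = _ := by rw [pow_succ]; ring
  have h2 : (#R : ℝ) * (2 * (1 / 2) ^ k) ≤ 2 * weight f := by
    calc (#R : ℝ) * (2 * (1 / 2) ^ k) = ∑ i ∈ R, 2 * (1 / 2 : ℝ) ^ k := by simp
      _ ≤ ∑ i ∈ R, omega (deriv i f) := sum_le_sum h1
      _ ≤ ∑ i, omega (deriv i f) :=
        sum_le_sum_of_subset_of_nonneg (subset_univ _) fun i _ _ => omega_nonneg _
      _ = _ := by rw [weight]; ring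
  have h3 := weight_le_const hf hd
  have h4 : (#R : ℝ) * (1 / 2) ^ k ≤ 4.394 := by linarith
  rw [one_div, inv_pow, ← div_eq_mul_inv, div_le_iff₀ (by positivity)] at h4
  exact h4

/-- A function such that each point is sensitive in exactly `k` directions has degree at
most `k`. -/
lemma degLE_of_sensitivity {f : (ι → ℤˣ) → ℝ} {k : ℕ}
    (h : ∀ x, ∑ i, (f x - f (flip {i} x)) / 2 = k * f x) : DegLE f k := by
  intro S hS
  -- The Laplacian multiplies the coefficient at `S` by `#S`, so `#S = k` wherever the coefficient
  -- is nonzero.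
  have h1 : coeff (fun x => ∑ i, (f x - f (flip {i} x)) / 2) S = #S * coeff f S := by
    rw [coeff_sum]
    have h2 : ∀ i, coeff (fun x => (f x - f (flip {i} x)) / 2) S =
        if i ∈ S then coeff f S else 0 := by
      intro i
      have h3 : coeff (fun x => f (flip {i} x)) S = if i ∈ S then -coeff f S else coeff f S := by
        have h4 := expect_flip {i} fun x => f (flip {i} x) * chi S x
        simp only [flip_flip, chi_flip_singleton] at h4
        rw [coeff, ← h4]
        split_ifs with hi
        · simp only [mul_neg]; rw [expect_neg_distrib]; rfl
        · rfl
      have h5 : (fun x => (f x - f (flip {i} x)) / 2) =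
          fun x => (1 / 2) * (f x - f (flip {i} x)) := by funext x; ring
      rw [h5, coeff_const_mul, coeff_sub, h3]
      split_ifs <;> ring
    simp only [h2]
    rw [sum_ite_mem, univ_inter]; simp
  simp only [h] at h1
  rw [coeff_const_mul] at h1
  have := mul_right_cancel₀ hS h1
  exact le_of_eq (by exact_mod_cast this.symm)

end Blocks

/-! ### Relevant variables and the doubling construction. -/

section Sensitivity

variable {ι κ : Type*} [Fintype ι] [DecidableEq ι] [Fintype κ] [DecidableEq κ]

/-- Every point is sensitive in exactly `k` directions. -/
def HasSensitivity (f : (ι → ℤˣ) → ℤˣ) (k : ℕ) : Prop :=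
  ∀ x, #(univ.filter fun i => f (flip {i} x) ≠ f x) = k

/-- `f` depends on every coordinate. -/
def AllRelevant (f : (ι → ℤˣ) → ℤˣ) : Prop := ∀ i, ∃ x, f (flip {i} x) ≠ f x

lemma exists_irrelevant {f : (ι → ℤˣ) → ℤˣ} {k : ℕ} (hf : HasSensitivity f k)
    (h : 4.394 * 2 ^ k < (Fintype.card ι : ℝ)) : ∃ i, ∀ x, f (flip {i} x) = f x := by
  classical
  by_contra! hcon
  set g : (ι → ℤˣ) → ℝ := fun x => ((f x : ℤ) : ℝ) with hg
  have hsign : IsSign g := by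
    intro x
    rcases Int.units_eq_one_or (f x) with h | h <;> simp [hg, h]
  have hne : ∀ x y, g x ≠ g y ↔ f x ≠ f y := by
    intro x y; simp [hg, Units.ext_iff]
  have hdeg : DegLE g k := by
    refine degLE_of_sensitivity fun x => ?_
    have h1 : ∀ i, (g x - g (flip {i} x)) / 2 = if f (flip {i} x) ≠ f x then g x else 0 := by
      intro i
      split_ifs with hi
      · rw [← hne] at hi
        rcases hsign x with h2 | h2 <;> rcases hsign (flip {i} x) with h3 | h3 <;>
          rw [h2, h3] at hi ⊢ <;> first | exact absurd rfl hi | norm_num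
      · rw [← hne, not_not] at hi
        rw [hi]; ring
    simp only [h1]
    rw [← sum_filter, sum_const, hf x, nsmul_eq_mul]
  have h2 := card_relevant_le hsign hdeg
  rw [filter_true_of_mem] at h2
  · rw [card_univ] at h2; linarith
  · intro i _
    obtain ⟨x, hx⟩ := hcon i
    exact ⟨x, (hne _ _).mpr hx⟩

lemma HasSensitivity.comp {f : (κ → ℤˣ) → ℤˣ} {k : ℕ} (hf : HasSensitivity f k)
    (ρ : ι ≃ κ) (ψ : (ι → ℤˣ) → κ → ℤˣ) (h : ∀ x i, ψ (flip {i} x) = flip {ρ i} (ψ x)) :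
    HasSensitivity (fun x => f (ψ x)) k := by
  intro x
  rw [← hf (ψ x)]
  refine card_bij (fun i _ => ρ i) ?_ (fun _ _ _ _ h => ρ.injective h) ?_
  · intro i hi
    simpa [h] using hi
  · intro j hj
    refine ⟨ρ.symm j, ?_, by simp⟩
    simpa [h] using hj

omit [Fintype ι] [Fintype κ] in
lemma flip_comp_equiv (e : ι ≃ κ) (i : ι) (x : ι → ℤˣ) :
    flip {i} x ∘ e.symm = flip {e i} (x ∘ e.symm) := by
  funext j
  simp [flip, Equiv.symm_apply_eq]

lemma unit_ne_iff (a b : ℤˣ) : a ≠ b ↔ a = -b := by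
  rcases Int.units_eq_one_or a with h | h <;> rcases Int.units_eq_one_or b with h' | h' <;>
    subst h <;> subst h' <;> decide

/-- The multiplexer-like combination of two copies of `f`, selected by two additional variables. -/
def double (f : (ι → ℤˣ) → ℤˣ) (z : ι ⊕ ι ⊕ Bool → ℤˣ) : ℤˣ :=
  z (.inr (.inr true)) *
    if z (.inr (.inr true)) = z (.inr (.inr false)) then f fun i => z (.inl i)
    else f fun i => z (.inr (.inl i))

omit [Fintype ι] in
lemma double_flip_inl (f : (ι → ℤˣ) → ℤˣ) (z : ι ⊕ ι ⊕ Bool → ℤˣ) (i : ι) :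
    double f (flip {.inl i} z) = z (.inr (.inr true)) *
      if z (.inr (.inr true)) = z (.inr (.inr false)) then f (flip {i} fun i => z (.inl i))
      else f fun i => z (.inr (.inl i)) := by
  have h : (fun j => flip {Sum.inl i} z (.inl j)) = flip {i} fun j => z (.inl j) := by
    funext j; simp [flip]
  rw [double, h]
  simp [flip]

omit [Fintype ι] in
lemma double_flip_inr (f : (ι → ℤˣ) → ℤˣ) (z : ι ⊕ ι ⊕ Bool → ℤˣ) (i : ι) :
    double f (flip {.inr (.inl i)} z) = z (.inr (.inr true)) *
      if z (.inr (.inr true)) = z (.inr (.inr false)) then f fun i => z (.inl i)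
      else f (flip {i} fun i => z (.inr (.inl i))) := by
  have h : (fun j => flip {Sum.inr (Sum.inl i)} z (.inr (.inl j))) =
      flip {i} fun j => z (.inr (.inl j)) := by
    funext j; simp [flip]
  rw [double, h]
  simp [flip]

omit [Fintype ι] in
lemma double_flip_true (f : (ι → ℤˣ) → ℤˣ) (z : ι ⊕ ι ⊕ Bool → ℤˣ) :
    double f (flip {.inr (.inr true)} z) = -z (.inr (.inr true)) *
      if z (.inr (.inr true)) = z (.inr (.inr false)) then f fun i => z (.inr (.inl i))
      else f fun i => z (.inl i) := by
  by_cases h : z (.inr (.inr true)) = z (.inr (.inr false))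
  · simp [double, flip, h, (units_ne_neg_self _).symm]
  · have h' := (unit_ne_iff _ _).mp h
    simp [double, flip, h', (units_ne_neg_self _).symm]

omit [Fintype ι] in
lemma double_flip_false (f : (ι → ℤˣ) → ℤˣ) (z : ι ⊕ ι ⊕ Bool → ℤˣ) :
    double f (flip {.inr (.inr false)} z) = z (.inr (.inr true)) *
      if z (.inr (.inr true)) = z (.inr (.inr false)) then f fun i => z (.inr (.inl i))
      else f fun i => z (.inl i) := by
  by_cases h : z (.inr (.inr true)) = z (.inr (.inr false))
  · simp [double, flip, h, units_ne_neg_self]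
  · have h' := (unit_ne_iff _ _).mp h
    simp [double, flip, h', (units_ne_neg_self _).symm]

/-- The selected copy contributes `k` sensitive directions and the idle copy none. Flipping either
selector reads the other copy, but only one of these flips changes the leading sign; the two results
are opposite, so exactly one selector is sensitive. -/
lemma HasSensitivity.double {f : (ι → ℤˣ) → ℤˣ} {k : ℕ} (hf : HasSensitivity f k) :
    HasSensitivity (double f) (k + 1) := by
  intro z
  rw [card_filter, Fintype.sum_sum_type, Fintype.sum_sum_type, Fintype.sum_bool]
  simp only [double_flip_inl, double_flip_inr, double_flip_true, double_flip_false]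
  simp only [HypercubeStable.double]
  have h1 := hf fun i => z (.inl i)
  have h2 := hf fun i => z (.inr (.inl i))
  rw [card_filter] at h1 h2
  by_cases h : z (.inr (.inr true)) = z (.inr (.inr false))
  all_goals
    simp only [h, if_true, if_false, ne_eq, mul_right_inj, not_true_eq_false, sum_const_zero]
    simp only [ne_eq] at h1 h2
    first | rw [h1] | rw [h2]
    generalize z (.inr (.inr true)) = a
    generalize z (.inr (.inr false)) = a'
    generalize (f fun i => z (.inl i)) = b
    generalize (f fun i => z (.inr (.inl i))) = c
    rcases Int.units_eq_one_or a with rfl | rfl <;>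
    rcases Int.units_eq_one_or a' with rfl | rfl <;>
    rcases Int.units_eq_one_or b with rfl | rfl <;>
    rcases Int.units_eq_one_or c with rfl | rfl <;> simp (decide := true)

omit [Fintype ι] in
lemma AllRelevant.double [Nonempty ι] {f : (ι → ℤˣ) → ℤˣ} (hf : AllRelevant f) :
    AllRelevant (double f) := by
  obtain ⟨i₀⟩ := ‹Nonempty ι›
  obtain ⟨x₀, hx₀⟩ := hf i₀
  rintro (i | i | b)
  · obtain ⟨x, hx⟩ := hf i
    refine ⟨Sum.elim x 1, ?_⟩
    rw [double_flip_inl, HypercubeStable.double]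
    simpa using hx
  · obtain ⟨x, hx⟩ := hf i
    refine ⟨Sum.elim 1 (Sum.elim x fun b => if b then 1 else -1), ?_⟩
    rw [double_flip_inr, HypercubeStable.double]
    simpa using hx
  · cases b
    · refine ⟨Sum.elim x₀ (Sum.elim (flip {i₀} x₀) 1), ?_⟩
      rw [double_flip_false, HypercubeStable.double]
      simpa using hx₀
    · refine ⟨Sum.elim x₀ (Sum.elim x₀ 1), ?_⟩
      rw [double_flip_true, HypercubeStable.double]
      simp

/-- Doubling sends `m` to `2m + 2`, so `m + 2` doubles, starting from `3` for a single variable. -/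
lemma exists_allRelevant (j m : ℕ) (hm : m + 2 = 3 * 2 ^ j) : ∃ f : (Fin m → ℤˣ) → ℤˣ,
    HasSensitivity f (j + 1) ∧ AllRelevant f := by
  induction j generalizing m with
  | zero =>
    obtain rfl : m = 1 := by omega
    refine ⟨fun x => x 0, fun x => ?_, fun i => ⟨1, ?_⟩⟩
    · rw [filter_true_of_mem]
      · simp
      · intro i _
        obtain rfl : i = 0 := Subsingleton.elim i 0
        simp [flip, (units_ne_neg_self _).symm]
    · obtain rfl : i = 0 := Subsingleton.elim i 0
      simp [flip]
  | succ j ih =>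
    have hpos : 1 ≤ 2 ^ j := Nat.one_le_two_pow
    obtain ⟨l, hl⟩ : ∃ l, l + 1 + 2 = 3 * 2 ^ j := ⟨3 * 2 ^ j - 3, by omega⟩
    obtain ⟨f, hf, hr⟩ := ih (l + 1) hl
    have e : Fin m ≃ Fin (l + 1) ⊕ Fin (l + 1) ⊕ Bool :=
      Fintype.equivOfCardEq (by
        simp only [Fintype.card_fin, Fintype.card_sum, Fintype.card_bool]
        rw [pow_succ] at hm
        omega)
    refine ⟨fun x => double f (x ∘ e.symm), hf.double.comp e _ fun x i => flip_comp_equiv e i x,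
      fun i => ?_⟩
    obtain ⟨x, hx⟩ := hr.double (e i)
    refine ⟨x ∘ e, ?_⟩
    have h1 : (x ∘ e) ∘ e.symm = x := by funext l; simp
    change double f (flip {i} (x ∘ e) ∘ e.symm) ≠ double f ((x ∘ e) ∘ e.symm)
    rw [flip_comp_equiv, h1]
    exact hx

end Sensitivity

/-! ### Automorphisms of the cube, extension by a dummy coordinate, and `G`. -/

section Cube

variable {n : ℕ}

lemma cube_adj_iff (x y : Fin n → ℤˣ) : (cube n).Adj x y ↔ ∃ i, y = flip {i} x := by
  change hammingDist x y = 1 ↔ _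
  rw [hammingDist, card_eq_one]
  refine exists_congr fun i => ?_
  constructor
  · intro h
    funext j
    have hj : j ∈ univ.filter (fun i => x i ≠ y i) ↔ j ∈ ({i} : Finset (Fin n)) := by rw [h]
    simp only [mem_filter, mem_univ, true_and, mem_singleton] at hj
    by_cases hji : j = i
    · rw [flip_apply, if_pos (by simpa using hji)]
      exact (unit_ne_iff _ _).mp (hj.mpr hji).symm
    · rw [flip_apply, if_neg (by simpa using hji)]
      by_contra hne
      exact hji (hj.mp (Ne.symm hne))
  · rintro rfl
    ext j
    by_cases hji : j = i <;> simp [flip, hji, units_ne_neg_self]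

lemma isKFunction_iff (k : ℕ) (f : (Fin n → ℤˣ) → ℤˣ) :
    IsKFunction n k f ↔ HasSensitivity f k := by
  refine forall_congr' fun v => ?_
  have : {w | (cube n).Adj v w ∧ f v ≠ f w} =
      (fun i => flip {i} v) '' (univ.filter fun i => f (flip {i} v) ≠ f v : Finset (Fin n)) := by
    ext w
    simp only [cube_adj_iff, Set.mem_ofPred_eq, Set.mem_image, mem_coe, mem_filter, mem_univ,
      true_and]
    constructor
    · rintro ⟨⟨i, rfl⟩, h⟩
      exact ⟨i, h.symm, rfl⟩
    · rintro ⟨i, h, rfl⟩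
      exact ⟨⟨i, rfl⟩, h.symm⟩
  rw [this, Set.ncard_image_of_injective _ fun i j h =>
    singleton_injective (flip_left_injective v h), Set.ncard_coe_finset]

lemma flip_insert {ι : Type*} [DecidableEq ι] {i : ι} {T : Finset ι} (hi : i ∉ T) (x : ι → ℤˣ) :
    flip (insert i T) x = flip {i} (flip T x) := by
  funext j
  by_cases h : j = i
  · subst h; simp [flip, hi]
  · simp [flip, h]

lemma exists_flip_one {ι : Type*} [Fintype ι] [DecidableEq ι] (x : ι → ℤˣ) : ∃ T, x = flip T 1 := by
  refine ⟨univ.filter fun i => x i ≠ 1, ?_⟩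
  funext i
  by_cases h : x i = 1
  · simp [flip, h]
  · have := (unit_ne_iff _ _).mp h
    simp [flip, this]

/-- An automorphism of the cube permutes the directions. -/
lemma exists_perm (φ : cube n ≃g cube n) :
    ∃ π : Fin n ≃ Fin n, ∀ x i, φ (flip {i} x) = flip {π i} (φ x) := by
  have hex : ∀ x i, ∃ j, φ (flip {i} x) = flip {j} (φ x) := by
    intro x i
    rw [← cube_adj_iff, φ.map_adj_iff, cube_adj_iff]
    exact ⟨i, rfl⟩
  choose p hp using hex
  have hinj : ∀ x, Injective (p x) := by
    intro x i j h
    have h1 : φ (flip {i} x) = φ (flip {j} x) := by rw [hp, hp, h]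
    exact singleton_injective (flip_left_injective x (φ.injective h1))
  -- Images of 2-faces: walking `j` then `i`, or `i` then `j`, reaches the same vertex, so the two
  -- pairs of image directions coincide.
  have hstep : ∀ j x i, p (flip {j} x) i = p x i := by
    intro j x i
    have h1 : flip {p (flip {j} x) i} (flip {p x j} (φ x)) =
        flip {p (flip {i} x) j} (flip {p x i} (φ x)) := by
      rw [← hp x j, ← hp x i, ← hp, ← hp, flip_comm]
    rw [flip_symmDiff, flip_symmDiff] at h1
    have h2 := flip_left_injective _ h1
    by_cases hij : i = j
    · subst hij
      have h3 : φ (flip {i} (flip {i} x)) = φ x := by rw [flip_flip]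
      rw [hp, hp, flip_symmDiff] at h3
      have h4 := flip_left_injective (φ x) (h3.trans (flip_empty _).symm)
      exact singleton_injective (symmDiff_eq_bot.mp h4)
    · have hab : p x i ≠ p x j := (hinj x).ne hij
      have ha : p (flip {j} x) i ≠ p x j := by
        intro h
        have h3 : φ (flip {i} (flip {j} x)) = φ x := by rw [hp, hp, h, flip_flip]
        have h4 := φ.injective h3
        rw [flip_symmDiff] at h4
        have h5 := flip_left_injective x (h4.trans (flip_empty _).symm)
        exact hij (singleton_injective (symmDiff_eq_bot.mp h5))
      have h3 : p x j ∈ ({p (flip {j} x) i} : Finset (Fin n)) ∆ {p x j} := by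
        simp [mem_symmDiff, ha.symm]
      rw [h2] at h3
      simp only [mem_symmDiff, mem_singleton, hab.symm, not_false_eq_true, and_true, false_and,
        or_false] at h3
      have h4 : p (flip {j} x) i ∈ ({p (flip {j} x) i} : Finset (Fin n)) ∆ {p x j} := by
        simp [mem_symmDiff, ha]
      rw [h2, ← h3] at h4
      simp only [mem_symmDiff, mem_singleton, ha, false_and, not_false_eq_true, and_true,
        false_or] at h4
      exact h4
  have hconst : ∀ T : Finset (Fin n), p (flip T 1) = p 1 := by
    intro T
    induction T using Finset.induction_on with
    | empty => rw [flip_empty]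
    | insert j T hj ih =>
      rw [flip_insert hj]
      funext i
      rw [hstep, ih]
  refine ⟨Equiv.ofBijective (p 1) (Finite.injective_iff_bijective.mp (hinj 1)), fun x i => ?_⟩
  obtain ⟨T, rfl⟩ := exists_flip_one x
  rw [hp, hconst]; rfl

/-- A map which permutes the directions is an automorphism of the cube. -/
lemma exists_iso {ψ : (Fin n → ℤˣ) → Fin n → ℤˣ} {ρ : Fin n → Fin n} (hρ : Injective ρ)
    (h : ∀ x i, ψ (flip {i} x) = flip {ρ i} (ψ x)) :
    ∃ φ : cube n ≃g cube n, ∀ x, φ x = ψ x := by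
  have hT : ∀ (T : Finset (Fin n)) x, ψ (flip T x) = flip (T.image ρ) (ψ x) := by
    intro T x
    induction T using Finset.induction_on with
    | empty => simp
    | insert j T hj ih =>
      rw [flip_insert hj, h, ih, image_insert, flip_insert]
      simpa [hρ.eq_iff] using hj
  have hψ : Injective ψ := by
    intro x y hxy
    obtain ⟨S, rfl⟩ := exists_flip_one x
    obtain ⟨T, rfl⟩ := exists_flip_one y
    rw [hT, hT] at hxy
    rw [image_injective hρ (flip_left_injective _ hxy)]
  have hρ' := Finite.injective_iff_surjective.mp hρ
  refine ⟨⟨Equiv.ofBijective ψ (Finite.injective_iff_bijective.mp hψ), ?_⟩, fun x => rfl⟩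
  intro x y
  simp only [Equiv.ofBijective_apply, cube_adj_iff]
  constructor
  · rintro ⟨j, hj⟩
    obtain ⟨i, rfl⟩ := hρ' j
    exact ⟨i, hψ (by rw [hj, h])⟩
  · rintro ⟨i, rfl⟩
    exact ⟨ρ i, h x i⟩

/-- Extension of a Boolean function to a cube with one more dimension. -/
def extend (f : (Fin n → ℤˣ) → ℤˣ) (y : Fin (n + 1) → ℤˣ) : ℤˣ := f (Fin.init y)

lemma init_flip_last (y : Fin (n + 1) → ℤˣ) : Fin.init (flip {Fin.last n} y) = Fin.init y := by
  funext i
  simp [Fin.init, flip, (Fin.castSucc_lt_last i).ne]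

lemma init_flip_castSucc (y : Fin (n + 1) → ℤˣ) (i : Fin n) :
    Fin.init (flip {i.castSucc} y) = flip {i} (Fin.init y) := by
  funext j
  simp [Fin.init, flip]

lemma snoc_flip (x : Fin n → ℤˣ) (b : ℤˣ) (i : Fin n) :
    (Fin.snoc (flip {i} x) b : Fin (n + 1) → ℤˣ) = flip {i.castSucc} (Fin.snoc x b) := by
  funext j
  refine Fin.lastCases ?_ (fun j => ?_) j
  · simp [flip, (Fin.castSucc_lt_last i).ne']
  · simp [flip]

lemma extend_flip_last (f : (Fin n → ℤˣ) → ℤˣ) (y : Fin (n + 1) → ℤˣ) :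
    extend f (flip {Fin.last n} y) = extend f y := by
  rw [extend, init_flip_last, extend]

lemma hasSensitivity_extend (f : (Fin n → ℤˣ) → ℤˣ) (k : ℕ) :
    HasSensitivity (extend f) k ↔ HasSensitivity f k := by
  have h : ∀ y, #(univ.filter fun i => extend f (flip {i} y) ≠ extend f y) =
      #(univ.filter fun i => f (flip {i} (Fin.init y)) ≠ f (Fin.init y)) := by
    intro y
    rw [card_filter, card_filter, Fin.sum_univ_castSucc, extend_flip_last]
    simp [extend, init_flip_castSucc]
  constructor
  · intro hf x
    have := hf (Fin.snoc x 1)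
    rw [h] at this
    simpa [Fin.init_snoc] using this
  · intro hf y
    rw [h, hf]

lemma Isomorphic.extend {f g : (Fin n → ℤˣ) → ℤˣ} (h : Isomorphic f g) :
    Isomorphic (extend f) (extend g) := by
  obtain ⟨φ, ε, hφ⟩ := h
  obtain ⟨π, hπ⟩ := exists_perm φ
  obtain ⟨Φ, hΦ⟩ := exists_iso (n := n + 1)
    (ψ := fun y => Fin.snoc (φ (Fin.init y)) (y (Fin.last n)))
    (ρ := Fin.lastCases (Fin.last n) fun i => (π i).castSucc)
    (by
      intro i j
      refine Fin.lastCases ?_ (fun i => ?_) i <;> refine Fin.lastCases ?_ (fun j => ?_) j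
      · simp
      · intro h; simp at h; exact absurd h.symm (Fin.castSucc_lt_last _).ne
      · intro h; simp at h
      · intro h; simpa using h)
    (by
      intro y i
      refine Fin.lastCases ?_ (fun i => ?_) i
      · simp only [init_flip_last, Fin.lastCases_last]
        funext j
        refine Fin.lastCases ?_ (fun j => ?_) j
        · simp [flip]
        · simp [flip, (Fin.castSucc_lt_last j).ne]
      · simp only [init_flip_castSucc, Fin.lastCases_castSucc, hπ]
        rw [snoc_flip]
        congr 2
        simp [flip, (Fin.castSucc_lt_last i).ne'])
  refine ⟨Φ, ε, fun y => ?_⟩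
  rw [hΦ, HypercubeStable.extend, HypercubeStable.extend, Fin.init_snoc, hφ]

/-- A function isomorphic to an extension has an irrelevant coordinate. -/
lemma Isomorphic.exists_irrelevant {h : (Fin (n + 1) → ℤˣ) → ℤˣ} {g : (Fin n → ℤˣ) → ℤˣ}
    {Φ : cube (n + 1) ≃g cube (n + 1)} {ε : ℤˣ} (hh : ∀ y, h y = ε * HypercubeStable.extend g (Φ y))
    {π : Fin (n + 1) ≃ Fin (n + 1)} (hπ : ∀ x i, Φ (flip {i} x) = flip {π i} (Φ x))
    (y : Fin (n + 1) → ℤˣ) : h (flip {π.symm (Fin.last n)} y) = h y := by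
  rw [hh, hπ, Equiv.apply_symm_apply, extend_flip_last, ← hh]

lemma comp_swap_flip {ι : Type*} [DecidableEq ι] (a b i : ι) (x : ι → ℤˣ) :
    flip {i} x ∘ Equiv.swap a b = flip {Equiv.swap a b i} (x ∘ Equiv.swap a b) := by
  have := flip_comp_equiv (Equiv.swap a b) i x
  rwa [Equiv.symm_swap] at this

/-- Transposing two entries either does nothing or negates both. -/
lemma apply_comp_swap {ι : Type*} [DecidableEq ι] {f : (ι → ℤˣ) → ℤˣ} {a b : ι}
    (ha : ∀ x, f (flip {a} x) = f x) (hb : ∀ x, f (flip {b} x) = f x) (x : ι → ℤˣ) :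
    f (x ∘ Equiv.swap a b) = f x := by
  by_cases hx : x a = x b
  · congr 1
    funext i
    simp only [comp_apply]
    by_cases h1 : i = a
    · rw [h1, Equiv.swap_apply_left, hx]
    by_cases h2 : i = b
    · rw [h2, Equiv.swap_apply_right, hx]
    rw [Equiv.swap_apply_of_ne_of_ne h1 h2]
  · have hab : a ≠ b := by rintro rfl; exact hx rfl
    rw [← ha x, ← hb (flip {a} x)]
    congr 1
    have hx' := (unit_ne_iff _ _).mp hx
    funext i
    simp only [comp_apply]
    by_cases h1 : i = a
    · rw [h1, Equiv.swap_apply_left]; simp [flip, hab, hx']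
    by_cases h2 : i = b
    · rw [h2, Equiv.swap_apply_right]; simp [flip, hab.symm, hx']
    rw [Equiv.swap_apply_of_ne_of_ne h1 h2]
    simp [flip, h1, h2]

/-- The automorphism may carry some direction `a` other than the last to the last one. Then `a` and
the last direction are both irrelevant for `extend f`, so they may be swapped first; afterwards the
automorphism descends to `Q_n`. -/
lemma Isomorphic.of_extend {f g : (Fin n → ℤˣ) → ℤˣ}
    (h : Isomorphic (HypercubeStable.extend f) (HypercubeStable.extend g)) : Isomorphic f g := by
  obtain ⟨Φ, ε, hΦ⟩ := h
  obtain ⟨π, hπ⟩ := exists_perm Φ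
  set a := π.symm (Fin.last n) with ha
  set s := Equiv.swap a (Fin.last n) with hs
  have hinv : ∀ y, HypercubeStable.extend f (y ∘ s) = HypercubeStable.extend f y :=
    apply_comp_swap (Isomorphic.exists_irrelevant hΦ hπ) (extend_flip_last f)
  have hne : ∀ i : Fin n, π (s i.castSucc) ≠ Fin.last n := by
    intro i hi
    rw [← Equiv.eq_symm_apply, ← ha, ← Equiv.swap_apply_right a (Fin.last n), ← hs] at hi
    exact (Fin.castSucc_lt_last i).ne (s.injective hi)
  have hex : ∀ i : Fin n, ∃ j : Fin n, j.castSucc = π (s i.castSucc) := fun i =>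
    Fin.exists_castSucc_eq.mpr (hne i)
  choose ρ hρ using hex
  obtain ⟨φ, hφ⟩ := exists_iso (ψ := fun x => Fin.init (Φ (Fin.snoc x 1 ∘ s))) (ρ := ρ)
    (by
      intro i j hij
      have h1 : (ρ i).castSucc = (ρ j).castSucc := by rw [hij]
      rw [hρ, hρ] at h1
      exact Fin.castSucc_injective n (s.injective (π.injective h1)))
    (by
      intro x i
      rw [snoc_flip, hs, comp_swap_flip, ← hs, hπ, ← hρ, init_flip_castSucc])
  refine ⟨φ, ε, fun x => ?_⟩
  have h1 := hΦ (Fin.snoc x 1 ∘ s)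
  rw [hinv] at h1
  simpa [HypercubeStable.extend, Fin.init_snoc, hφ] using h1

/-- The map on isomorphism classes of `k`-functions induced by extension. -/
def extendClass (n k : ℕ) : Quotient (kFunctionSetoid n k) → Quotient (kFunctionSetoid (n + 1) k) :=
  Quotient.map (fun f => ⟨extend f.1, (isKFunction_iff k _).mpr
    ((hasSensitivity_extend f.1 k).mpr ((isKFunction_iff k f.1).mp f.2))⟩)
    fun _ _ h => Isomorphic.extend h

lemma extendClass_injective (n k : ℕ) : Injective (extendClass n k) := by
  intro p q
  induction p using Quotient.inductionOn with | _ f => ?_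
  induction q using Quotient.inductionOn with | _ g => ?_
  intro h
  exact Quotient.sound (Isomorphic.of_extend (Quotient.exact h))

lemma G_le_succ (n k : ℕ) : G n k ≤ G (n + 1) k :=
  Nat.card_le_card_of_injective _ (extendClass_injective n k)

lemma G_mono (k : ℕ) : Monotone fun n => G n k := monotone_nat_of_le_succ fun n => G_le_succ n k

/-- Beyond the threshold some coordinate is irrelevant; moving it to the last place exhibits the
function as an extension, so `extendClass` is onto. -/
lemma G_succ_eq {n k : ℕ} (h : 4.394 * (2 : ℝ) ^ k < n + 1) : G (n + 1) k = G n k := by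
  refine (Nat.card_congr (Equiv.ofBijective _ ⟨extendClass_injective n k, ?_⟩)).symm
  intro q
  induction q using Quotient.inductionOn with | _ f => ?_
  obtain ⟨f, hf⟩ := f
  have hf' := (isKFunction_iff k f).mp hf
  obtain ⟨a, ha⟩ := exists_irrelevant hf' (by simpa using h)
  set s := Equiv.swap a (Fin.last n) with hs
  set f' : (Fin (n + 1) → ℤˣ) → ℤˣ := fun y => f (y ∘ s) with hf'def
  have hlast : ∀ y, f' (flip {Fin.last n} y) = f' y := by
    intro y
    simp only [hf'def, hs]
    rw [comp_swap_flip, Equiv.swap_apply_right, ha]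
  set g : (Fin n → ℤˣ) → ℤˣ := fun x => f' (Fin.snoc x 1) with hg
  have hfg : extend g = f' := by
    funext y
    rw [extend, hg]
    rcases Int.units_eq_one_or (y (Fin.last n)) with h1 | h1
    · have : (Fin.snoc (Fin.init y) 1 : Fin (n + 1) → ℤˣ) = y := by
        rw [← h1, Fin.snoc_init_self]
      simp only [this]
    · have : (Fin.snoc (Fin.init y) 1 : Fin (n + 1) → ℤˣ) = flip {Fin.last n} y := by
        funext j
        refine Fin.lastCases ?_ (fun j => ?_) j
        · simp [flip, h1]
        · simp [flip, Fin.init, (Fin.castSucc_lt_last j).ne]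
      simp only [this, hlast]
  have hgk : HasSensitivity g k := by
    rw [← hasSensitivity_extend, hfg]
    exact hf'.comp s _ fun x i => comp_swap_flip a (Fin.last n) i x
  refine ⟨Quotient.mk _ ⟨g, (isKFunction_iff k g).mpr hgk⟩, Quotient.sound ?_⟩
  change Isomorphic (extend g) f
  rw [hfg]
  obtain ⟨φ, hφ⟩ := exists_iso (ψ := fun y : Fin (n + 1) → ℤˣ => y ∘ s) s.injective
    fun x i => comp_swap_flip a (Fin.last n) i x
  exact ⟨φ, 1, fun x => by rw [hφ, one_mul]⟩

/-- Equal finite counts would make the injection `extendClass` onto, and `f` would inherit an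
irrelevant direction from an extension. -/
lemma G_lt_succ {n k : ℕ} {f : (Fin (n + 1) → ℤˣ) → ℤˣ} (hf : HasSensitivity f k)
    (hr : AllRelevant f) : G n k < G (n + 1) k := by
  refine lt_of_le_of_ne (G_le_succ n k) fun heq => ?_
  have hbij := (extendClass_injective n k).bijective_of_nat_card_le heq.ge
  obtain ⟨p, hp⟩ := hbij.2 (Quotient.mk _ ⟨f, (isKFunction_iff k f).mpr hf⟩)
  induction p using Quotient.inductionOn with | _ g => ?_
  obtain ⟨Φ, ε, h⟩ : Isomorphic f (extend g.1) := Quotient.exact hp.symm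
  obtain ⟨π, hπ⟩ := exists_perm Φ
  obtain ⟨x, hx⟩ := hr (π.symm (Fin.last n))
  exact hx (Isomorphic.exists_irrelevant h hπ x)

lemma G_eq_of_le {k n : ℕ} (h : ⌊4.394 * (2 : ℝ) ^ k⌋₊ ≤ n) :
    G n k = G ⌊4.394 * (2 : ℝ) ^ k⌋₊ k := by
  induction n, h using Nat.le_induction with
  | base => rfl
  | succ n hn ih =>
    rw [← ih]
    refine G_succ_eq ?_
    have := Nat.lt_of_floor_lt (Nat.lt_succ_of_le hn)
    push_cast at this
    exact this

end Cube

end HypercubeStable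

/-! ### Assembly of the two bounds. -/

theorem theorem2 (k : ℕ) :
    MonotoneOn (fun n : ℕ => HypercubeStable.G n k) (Set.Ici k) ∧
    (∃ N : ℕ, k ≤ N ∧ ∀ n : ℕ, N ≤ n → HypercubeStable.G n k = HypercubeStable.G N k) ∧
    ∀ N : ℕ,
      IsLeast {m : ℕ | k ≤ m ∧
        ∀ n : ℕ, m ≤ n → HypercubeStable.G n k = HypercubeStable.G m k} N →
      3 * (2 : ℝ) ^ ((k : ℤ) - 1) - 2 ≤ (N : ℝ) ∧ (N : ℝ) ≤ 4.394 * (2 : ℝ) ^ k := by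
  have hk : k ≤ ⌊4.394 * (2 : ℝ) ^ k⌋₊ := by
    refine Nat.le_floor ?_
    have h1 : (k : ℝ) ≤ 2 ^ k := by exact_mod_cast Nat.lt_two_pow_self.le
    have h2 : (0 : ℝ) < 2 ^ k := by positivity
    norm_num
    linarith
  refine ⟨(HypercubeStable.G_mono k).monotoneOn _,
    ⟨_, hk, fun n hn => HypercubeStable.G_eq_of_le hn⟩, fun N hN => ⟨?_, ?_⟩⟩
  · obtain ⟨-, hconst⟩ := hN.1
    rcases k with _ | j
    -- For `k = 0` the lower bound is `-1/2`.
    · have : (0 : ℝ) ≤ N := Nat.cast_nonneg N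
      norm_num
      linarith
    have hpow : (2 : ℝ) ^ (((j + 1 : ℕ) : ℤ) - 1) = ((2 ^ j : ℕ) : ℝ) := by
      push_cast
      rw [add_sub_cancel_right, zpow_natCast]
    rw [hpow]
    have hpos : 1 ≤ 2 ^ j := Nat.one_le_two_pow
    obtain ⟨m, hm⟩ : ∃ m, m + 1 + 2 = 3 * 2 ^ j := ⟨3 * 2 ^ j - 3, by omega⟩
    obtain ⟨f, hf, hr⟩ := HypercubeStable.exists_allRelevant j (m + 1) hm
    have hlt := HypercubeStable.G_lt_succ hf hr
    -- `G` increases strictly from `m` to `m + 1 = 3 * 2^j - 2`, so it is not yet constant from `m`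
    -- on.
    have hle : m + 1 ≤ N := by
      by_contra hcon
      rw [hconst m (by omega), hconst (m + 1) (by omega)] at hlt
      exact lt_irrefl _ hlt
    have : 3 * 2 ^ j ≤ N + 2 := by omega
    have : (3 : ℝ) * ((2 ^ j : ℕ) : ℝ) ≤ N + 2 := by exact_mod_cast this
    linarith
  · have h1 : N ≤ ⌊4.394 * (2 : ℝ) ^ k⌋₊ :=
      hN.2 ⟨hk, fun n hn => HypercubeStable.G_eq_of_le hn⟩
    exact (Nat.le_floor_iff (by positivity)).mp h1
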